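/- Let $\mathbf W$ be a finite-dimensional real Hilbert space and $\mathbb D$ a linear operator on $\mathbf W$ such that, for some $\delta>0$, $\|e^{-t\mathbb D}\|\le e^{-\delta t}$ for all $t\ge 0$. Let $(\mathbf H,(e^{t\mathbb J_{\mathcal B}})_{t\in\mathbb R})$ be any minimal dilation of the contraction semigroup $(\mathbf W,(e^{-t\mathbb D})_{t\ge0})$; that is, $\mathbf H$ is a real Hilbert space containing $\mathbf W$ (up to a linear isometry) as a closed subspace, $(e^{t\mathbb J_{\mathcal B}})_{t\in\mathbb R}$ is a strongly continuous unitary group on $\mathbf H$, $\mathbb P e^{t\mathbb J_{\mathcal B}}|_{\mathbf W}=e^{-t\mathbb D}$ for all $t\ge 0$, where $\mathbb P$ is the orthogonal projection of $\mathbf H$ onto $\mathbf W$, and the span of $\bigcup_{t\in\mathbb R}e^{t\mathbb J_{\mathcal B}}\mathbf W$ is dense in $\mathbf H$. Then there exist a separable real Hilbert space $\mathbf X$, a bounded injective linear map $\mathbb N\colon\mathbf H\to\mathbf X$ with dense range, and a strongly continuous group $(\widehat S_t)_{t\in\mathbb R}$ of bounded linear operators on $\mathbf X$ such that \[ \mathbb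 N\mathbb N^*\colon\mathbf X\to\mathbf X\ \text{ is trace class} \qquad\text{and}\qquad \widehat S_t\,\mathbb N h=\mathbb N\,e^{t\mathbb J_{\mathcal B}}h\quad\text{for all } t\in\mathbb R,\ h\in\mathbf H . \] Moreover, $\mathbf X$ can be taken to be the largest space of the Gelfand triple of the $\mathbf W$-valued harmonic oscillator: there is a unitary map $U\colon\mathbf H\to L^2(\mathbb R;\mathbf W)$ with $(U e^{t\mathbb J_{\mathcal B}}h)(y)=(Uh)(y-t)$ for all $t\in\mathbb R$, $h\in\mathbf H$ and almost every $y$, and \[ \tfrac12\|\mathbb N h\|_{\mathbf X}^2=\sup_{v\in\mathrm{Dom}(\mathbb A)}\Big(\langle Uh,v\rangle_{L^2}-\tfrac12\|\mathbb A v\|_{L^2}^2\Big)\qquad\text{for all }h\in\mathbf H, \] where $\mathrm{Dom}(\mathbb A)=\{u\in H^2(\mathbb R;\mathbf W): (1+t^2)u\in L^2(\mathbb R;\mathbf W)\}$ and $(\mathbb A u)(t)=-\tfrac12u''(t)+\tfrac{t^2}2u(t)$. -/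

import Mathlib

open MeasureTheory
open scoped InnerProductSpace ContDiff

universe u

/-- A strongly continuous (one-parameter) group of bounded linear operators. -/
structure IsStronglyContinuousGroup {X : Type*} [NormedAddCommGroup X]
    [InnerProductSpace ℝ X] (S : ℝ → X →L[ℝ] X) : Prop where
  map_zero : S 0 = ContinuousLinearMap.id ℝ X
  map_add : ∀ s t : ℝ, S (s + t) = S s ∘L S t
  continuous_apply : ∀ x : X, Continuous fun t : ℝ => S t x

/-- A strongly continuous group of unitary operators on a Hilbert space, that is, a group
`exp (t J)` with a (in general unbounded) skew-adjoint generator `J`. -/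
structure IsStronglyContinuousUnitaryGroup {H : Type*} [NormedAddCommGroup H]
    [InnerProductSpace ℝ H] [CompleteSpace H] (S : ℝ → H →L[ℝ] H) : Prop
    extends IsStronglyContinuousGroup S where
  mem_unitary : ∀ t : ℝ, S t ∈ unitary (H →L[ℝ] H)

/-- `(H, S)` is a dilation of the semigroup `(C t)` (`t ≥ 0`) on `W`, where `W` is regarded as a
closed subspace of `H` through the linear isometry `Φ`. The adjoint `Φ†` is the orthogonal
projection of `H` onto (the copy of) `W`, so `compression` says that `P S_t` restricted to `W`
is `C_t`. -/
structure IsDilation {W H : Type*}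
    [NormedAddCommGroup W] [InnerProductSpace ℝ W] [CompleteSpace W]
    [NormedAddCommGroup H] [InnerProductSpace ℝ H] [CompleteSpace H]
    (C : ℝ → W →L[ℝ] W) (Φ : W →ₗᵢ[ℝ] H) (S : ℝ → H →L[ℝ] H) : Prop where
  unitaryGroup : IsStronglyContinuousUnitaryGroup S
  compression : ∀ t : ℝ, 0 ≤ t → ∀ w : W,
    ContinuousLinearMap.adjoint Φ.toContinuousLinearMap (S t (Φ w)) = C t w

/-- A minimal dilation: the span of the union over `t ∈ ℝ` of the subspaces `S_t W` is dense. -/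
structure IsMinimalDilation {W H : Type*}
    [NormedAddCommGroup W] [InnerProductSpace ℝ W] [CompleteSpace W]
    [NormedAddCommGroup H] [InnerProductSpace ℝ H] [CompleteSpace H]
    (C : ℝ → W →L[ℝ] W) (Φ : W →ₗᵢ[ℝ] H) (S : ℝ → H →L[ℝ] H) : Prop
    extends IsDilation C Φ S where
  minimal : Dense (Submodule.span ℝ (⋃ t : ℝ, S t '' Set.range Φ) : Set H)

/-- A bounded operator `T` on a Hilbert space is trace class if its absolute value `|T|`, the
positive square root of `T† T`, has finite trace: the series of the `⟪|T| eᵢ, eᵢ⟫` converges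
for every Hilbert basis `(eᵢ)`. -/
def IsTraceClass {X : Type u} [NormedAddCommGroup X]
    [InnerProductSpace ℝ X] [CompleteSpace X] (T : X →L[ℝ] X) : Prop :=
  ∃ P : X →L[ℝ] X, P.IsPositive ∧ P ∘L P = ContinuousLinearMap.adjoint T ∘L T ∧
    ∀ (ι : Type u) (e : HilbertBasis ι ℝ X), Summable fun i => ⟪P (e i), e i⟫_ℝ

/-- The Hilbert space `L²(ℝ; W)`. -/
abbrev L2Line (W : Type*) [NormedAddCommGroup W] : Type _ :=
  Lp W 2 (volume : Measure ℝ)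

/-- `v ∈ L²(ℝ; W)` is the weak derivative of `u ∈ L²(ℝ; W)`. -/
def IsWeakDeriv {W : Type*} [NormedAddCommGroup W] [InnerProductSpace ℝ W]
    (u v : L2Line W) : Prop :=
  ∀ φ : ℝ → ℝ, ContDiff ℝ ∞ φ → HasCompactSupport φ →
    ∫ x, deriv φ x • u x = -∫ x, φ x • v x

/-- The graph of the `W`-valued harmonic oscillator `A u = -u''/2 + t² u / 2`, with domain
`{u ∈ H²(ℝ; W) | (1 + t²) u ∈ L²(ℝ; W)}`: `u` is in the domain and `A u = f`. -/
def HarmonicOscillatorGraph {W : Type*} [NormedAddCommGroup W] [InnerProductSpace ℝ W]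
    (u f : L2Line W) : Prop :=
  MemLp (fun t : ℝ => (1 + t ^ 2) • u t) 2 volume ∧
  ∃ u' u'' : L2Line W, IsWeakDeriv u u' ∧ IsWeakDeriv u' u'' ∧
    ∀ᵐ t : ℝ, f t = -((1 / 2 : ℝ) • u'' t) + (t ^ 2 / 2) • u t

/-- `r` is the norm of `h ∈ L²(ℝ; W)` in the dual `V*` of `V = Dom A` (with `‖v‖_V = ‖A v‖`) in
the Gelfand triple `V ⊆ L²(ℝ; W) ⊆ V*` of the harmonic oscillator `A`:
`r² / 2 = sup_{v ∈ V} (⟪h, v⟫ - ‖A v‖² / 2)`. -/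
def IsGelfandDualNorm {W : Type*} [NormedAddCommGroup W] [InnerProductSpace ℝ W]
    (h : L2Line W) (r : ℝ) : Prop :=
  0 ≤ r ∧ IsLUB {a : ℝ | ∃ v f : L2Line W, HarmonicOscillatorGraph v f ∧
    a = ⟪h, v⟫_ℝ - (1 / 2) * ‖f‖ ^ 2} ((1 / 2) * r ^ 2)

/-! ### Hilbert space generalities: Gram matrices, orthogonal families, Hilbert–Schmidt operators.
-/

section HilbertSpace

variable {ι E F : Type*} [NormedAddCommGroup E] [InnerProductSpace ℝ E]
  [NormedAddCommGroup F] [InnerProductSpace ℝ F]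

/-! A minimal dilation is determined by the Gram matrix of the vectors `S t (Φ w)`, which unitarity
and compression reduce to `⟪exp (-(t - s) D) v, w⟫` for `s ≤ t`. An explicit family in `L²(ℝ; W)`
has the same Gram matrix. The decay bound makes `⟪D w, w⟫` positive definite, so `D + D† = R† R`
with `R` invertible. For the translates of `1_{y ≤ 0} R exp (y D) w` the inner products are
integrals of a total derivative, because `d/dy ⟪exp (y D) v, exp (y D) w⟫ = ⟪R exp (y D) v, R exp (y
D) w⟫`. These translates are total since `R exp (y D)` is surjective for every `y`. Thus
`exists_linearIsometryEquiv_of_gram` yields the unitary `U` that turns `S` into translation.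

Let `K` be the inverse of the harmonic oscillator `A`. It is diagonal in the Hermite basis with
eigenvalues `(n + 1/2)⁻¹` of multiplicity `dim W`, hence Hilbert–Schmidt, and completing the square
shows that `‖K h‖` is the dual norm of `h`. Put `N = U⁻¹ K U`. No completion is needed: `X` is `H`
with its own norm, and `N` plays the role of the embedding. Then `N N†` is trace class.

Translating by `s` replaces the potential `t² / 2` by `(t + s)² / 2`, so `A T_s = T_s (A + s t + s²
/ 2)` and `T_s K = K T_s (1 + s Q + s² / 2 K)`, where `Q = t K` is bounded. The adjoint of this
identity says that a bounded operator intertwines `N` with `S t`; this operator is the required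
extension (`exists_group_of_commutation`).

To use the weak definition of `A`, one shows that its graph is exactly that of `K` reversed. The
relations defining the domain hold on Hermite functions and pass to all `K h` by closedness;
conversely, testing against Hermite functions forces `v = K f`. -/

theorem inner_linearCombination (x : ι → E) (c d : ι →₀ ℝ) :
    ⟪Finsupp.linearCombination ℝ x c, Finsupp.linearCombination ℝ x d⟫_ℝ =
      c.sum fun i a => d.sum fun j b => a * (b * ⟪x i, x j⟫_ℝ) := by
  simp only [Finsupp.linearCombination_apply, Finsupp.sum, sum_inner, inner_sum,
    real_inner_smul_left, real_inner_smul_right]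
  rw [Finset.sum_comm]
  exact Finset.sum_congr rfl fun _ _ => Finset.sum_congr rfl fun _ _ => by ring

theorem norm_sq_linearCombination_of_orthogonal {x : ι → E}
    (hx : ∀ i j, i ≠ j → ⟪x i, x j⟫_ℝ = 0) (c : ι →₀ ℝ) :
    ‖Finsupp.linearCombination ℝ x c‖ ^ 2 = ∑ i ∈ c.support, c i ^ 2 * ‖x i‖ ^ 2 := by
  rw [← real_inner_self_eq_norm_sq, inner_linearCombination]
  refine Finset.sum_congr rfl fun i hi => ?_
  change ∑ j ∈ c.support, _ = _
  rw [Finset.sum_eq_single i]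
  · simp only [real_inner_self_eq_norm_sq]; ring
  · intro j _ hj
    simp only [hx i j hj.symm]; ring
  · intro h; exact absurd hi h

theorem denseRange_linearCombination {x : ι → E}
    (hx : Dense (Submodule.span ℝ (Set.range x) : Set E)) :
    DenseRange (Finsupp.linearCombination ℝ x) := by
  have : Set.range (Finsupp.linearCombination ℝ x) = Submodule.span ℝ (Set.range x) := by
    rw [← Finsupp.range_linearCombination]; rfl
  rw [DenseRange, this]
  exact hx

/-- Two families with dense spans and the same Gram matrix are related by a unitary map. -/
theorem exists_linearIsometryEquiv_of_gram [CompleteSpace E] [CompleteSpace F]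
    {x : ι → E} {y : ι → F} (hxy : ∀ i j, ⟪x i, x j⟫_ℝ = ⟪y i, y j⟫_ℝ)
    (hx : Dense (Submodule.span ℝ (Set.range x) : Set E))
    (hy : Dense (Submodule.span ℝ (Set.range y) : Set F)) :
    ∃ U : E ≃ₗᵢ[ℝ] F, ∀ i, U (x i) = y i := by
  set e := Finsupp.linearCombination ℝ x
  set f := Finsupp.linearCombination ℝ y
  have hnorm : ∀ c, ‖f c‖ = ‖e c‖ := fun c => by
    rw [← sq_eq_sq₀ (norm_nonneg _) (norm_nonneg _), ← real_inner_self_eq_norm_sq,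
      ← real_inner_self_eq_norm_sq, inner_linearCombination, inner_linearCombination]
    simp only [hxy]
  have he : DenseRange e := denseRange_linearCombination hx
  have hf : DenseRange f := denseRange_linearCombination hy
  set V := f.extendOfNorm e
  have hV : ∀ c, V (e c) = f c :=
    LinearMap.extendOfNorm_eq he ⟨1, fun c => by rw [one_mul]; exact (hnorm c).le⟩
  have hVn : ∀ z, ‖V z‖ = ‖z‖ := fun z =>
    isClosed_property (p := fun z => ‖V z‖ = ‖z‖) he
      (isClosed_eq (by fun_prop) (by fun_prop)) (fun c => by rw [hV, hnorm]) z
  let V' : E →ₗᵢ[ℝ] F := ⟨V.toLinearMap, hVn⟩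
  have hsurj : Function.Surjective V' := by
    have hcl : IsClosed (Set.range V') := V'.isometry.isClosedEmbedding.isClosed_range
    have hd : Dense (Set.range V') := hf.mono (by
      rintro _ ⟨c, rfl⟩
      exact ⟨e c, hV c⟩)
    rw [← Set.range_eq_univ, ← hcl.closure_eq, hd.closure_eq]
  refine ⟨LinearIsometryEquiv.ofSurjective V' hsurj, fun i => ?_⟩
  have h1 : V (x i) = y i := by simpa [e, f] using hV (Finsupp.single i 1)
  exact h1

theorem HilbertBasis.dense_span_range (b : HilbertBasis ι ℝ E) :
    Dense (Submodule.span ℝ (Set.range b) : Set E) :=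
  Submodule.dense_iff_topologicalClosure_eq_top.2 b.dense_span

/-- A bounded family of pairwise orthogonal vectors is the image of a Hilbert basis under a
bounded operator. -/
theorem HilbertBasis.exists_clm_of_orthogonal [CompleteSpace F] (b : HilbertBasis ι ℝ E)
    {w : ι → F} (hw : ∀ i j, i ≠ j → ⟪w i, w j⟫_ℝ = 0) {C : ℝ} (hC : ∀ i, ‖w i‖ ≤ C) :
    ∃ T : E →L[ℝ] F, ∀ i, T (b i) = w i := by
  have key : ∀ c : ι →₀ ℝ, ‖Finsupp.linearCombination ℝ w c‖ ≤
      |C| * ‖Finsupp.linearCombination ℝ b c‖ := fun c => by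
    refine le_of_sq_le_sq ?_ (by positivity)
    rw [mul_pow, norm_sq_linearCombination_of_orthogonal hw,
      norm_sq_linearCombination_of_orthogonal fun i j hij => b.orthonormal.2 hij, sq_abs,
      Finset.mul_sum]
    refine Finset.sum_le_sum fun i _ => ?_
    rw [b.orthonormal.1 i]
    have := pow_le_pow_left₀ (norm_nonneg _) (hC i) 2
    nlinarith [sq_nonneg (c i)]
  refine ⟨(Finsupp.linearCombination ℝ w).extendOfNorm (Finsupp.linearCombination ℝ b),
    fun i => ?_⟩
  have := LinearMap.extendOfNorm_eq (denseRange_linearCombination b.dense_span_range)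
    ⟨|C|, key⟩ (Finsupp.single i 1)
  simpa using this

theorem HilbertBasis.clm_ext (b : HilbertBasis ι ℝ E) {S T : E →L[ℝ] F}
    (h : ∀ i, S (b i) = T (b i)) : S = T := by
  refine ContinuousLinearMap.ext_on b.dense_span_range ?_
  rintro _ ⟨i, rfl⟩
  exact h i

theorem HilbertBasis.ext_inner (b : HilbertBasis ι ℝ E) {x y : E}
    (h : ∀ i, ⟪b i, x⟫_ℝ = ⟪b i, y⟫_ℝ) : x = y := by
  apply b.repr.injective
  ext i
  simpa [b.repr_apply_apply] using h i

/-- The adjoint of a Hilbert–Schmidt operator is Hilbert–Schmidt. -/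
theorem HilbertBasis.summable_norm_sq_adjoint [CompleteSpace E] [CompleteSpace F] {κ : Type*}
    (b : HilbertBasis ι ℝ E) (e : HilbertBasis κ ℝ F) (T : E →L[ℝ] F)
    (hT : Summable fun i => ‖T (b i)‖ ^ 2) :
    Summable fun k => ‖ContinuousLinearMap.adjoint T (e k)‖ ^ 2 := by
  have hs : ∀ x : E, HasSum (fun i => ⟪x, b i⟫_ℝ ^ 2) (‖x‖ ^ 2) := fun x => by
    have := b.hasSum_inner_mul_inner x x
    rw [real_inner_self_eq_norm_sq] at this
    simpa only [real_inner_comm x, ← sq] using this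
  refine summable_of_sum_le (c := ∑' i, ‖T (b i)‖ ^ 2) (fun _ => by positivity) fun s => ?_
  have h1 := hasSum_sum (s := s) fun k _ => hs (ContinuousLinearMap.adjoint T (e k))
  refine hasSum_le (fun i => ?_) h1 hT.hasSum
  simp only [ContinuousLinearMap.adjoint_inner_left]
  have := e.orthonormal.sum_inner_products_le (s := s) (T (b i))
  simpa using this

end HilbertSpace

/-! ### Hermite polynomials: ladder relations, orthonormality, spanning. -/

section HermiteFunctions

open Polynomial

theorem integrable_eval_mul_exp_neg_mul_sq (p : ℝ[X]) {b : ℝ} (hb : 0 < b) :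
    Integrable fun t : ℝ => p.eval t * Real.exp (-b * t ^ 2) := by
  induction p using Polynomial.induction_on' with
  | add p q hp hq =>
    simp only [eval_add, add_mul]
    exact hp.add hq
  | monomial n a =>
    have h := integrable_rpow_mul_exp_neg_mul_sq hb (s := n)
      (by have : (0 : ℝ) ≤ n := n.cast_nonneg
          linarith)
    simpa only [eval_monomial, mul_assoc, Real.rpow_natCast] using h.const_mul a

/-- The function `p(t) exp (-t² / 2)`. -/
noncomputable def gaussPoly (p : ℝ[X]) (t : ℝ) : ℝ := p.eval t * Real.exp (-(1 / 2) * t ^ 2)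

theorem gaussPoly_mul (p q : ℝ[X]) (t : ℝ) :
    gaussPoly p t * gaussPoly q t = (p * q).eval t * Real.exp (-1 * t ^ 2) := by
  have : Real.exp (-1 * t ^ 2) = Real.exp (-(1 / 2) * t ^ 2) * Real.exp (-(1 / 2) * t ^ 2) := by
    rw [← Real.exp_add]; ring_nf
  rw [this, eval_mul, gaussPoly, gaussPoly]
  ring

theorem gaussPoly_add (p q : ℝ[X]) (t : ℝ) :
    gaussPoly (p + q) t = gaussPoly p t + gaussPoly q t := by
  simp [gaussPoly, add_mul]

theorem gaussPoly_smul (a : ℝ) (p : ℝ[X]) (t : ℝ) :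
    gaussPoly (a • p) t = a * gaussPoly p t := by
  simp [gaussPoly, mul_assoc]

theorem gaussPoly_X_mul (p : ℝ[X]) (t : ℝ) : gaussPoly (X * p) t = t * gaussPoly p t := by
  simp [gaussPoly, mul_assoc]

theorem contDiff_gaussPoly (p : ℝ[X]) : ContDiff ℝ ∞ (gaussPoly p) := by
  have : ContDiff ℝ ∞ fun t : ℝ => p.eval t := by
    simpa [aeval_def] using p.contDiff_aeval (𝕜 := ℝ) (R := ℝ) ∞
  unfold gaussPoly
  fun_prop

theorem hasDerivAt_gaussPoly (p : ℝ[X]) (t : ℝ) :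
    HasDerivAt (gaussPoly p) (gaussPoly (derivative p - X * p) t) t := by
  have h2 : HasDerivAt (fun t : ℝ => -(1 / 2) * t ^ 2) (-t) t := by
    have := (hasDerivAt_pow 2 t).const_mul (-(1 / 2) : ℝ)
    refine this.congr_deriv ?_
    norm_num
    ring
  refine ((p.hasDerivAt t).mul h2.exp).congr_deriv ?_
  simp only [gaussPoly, eval_sub, eval_mul, eval_X]
  ring

theorem integrable_gaussPoly_mul (p q : ℝ[X]) :
    Integrable fun t => gaussPoly p t * gaussPoly q t := by
  simpa only [gaussPoly_mul] using integrable_eval_mul_exp_neg_mul_sq (p * q) one_pos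

theorem memLp_gaussPoly (p : ℝ[X]) : MemLp (gaussPoly p) 2 := by
  rw [memLp_two_iff_integrable_sq (contDiff_gaussPoly p).continuous.aestronglyMeasurable]
  simpa only [sq] using integrable_gaussPoly_mul p p

/-- Integration by parts: `2X - d/dX` is the adjoint of `d/dX` for the weight `exp (-t²)`. -/
theorem integral_gaussPoly_mul_raise (p q : ℝ[X]) :
    ∫ t, gaussPoly ((2 : ℝ) • (X * p) - derivative p) t * gaussPoly q t =
      ∫ t, gaussPoly p t * gaussPoly (derivative q) t := by
  have h := integral_mul_deriv_eq_deriv_mul_of_integrable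
    (fun x _ => hasDerivAt_gaussPoly p x) (fun x _ => hasDerivAt_gaussPoly q x)
    (integrable_gaussPoly_mul _ _) (integrable_gaussPoly_mul _ _) (integrable_gaussPoly_mul _ _)
  have h1 : ∀ t, gaussPoly ((2 : ℝ) • (X * p) - derivative p) t * gaussPoly q t =
      gaussPoly (X * p) t * gaussPoly q t - gaussPoly (derivative p - X * p) t * gaussPoly q t :=
    fun t => by
      simp only [gaussPoly, eval_sub, eval_smul, smul_eq_mul]
      ring
  have h2 : ∀ t, gaussPoly p t * gaussPoly (derivative q) t =
      gaussPoly (X * p) t * gaussPoly q t + gaussPoly p t * gaussPoly (derivative q - X * q) t :=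
    fun t => by
      simp only [gaussPoly, eval_sub, eval_mul, eval_X]
      ring
  simp only [h1, h2]
  rw [integral_sub (integrable_gaussPoly_mul _ _) (integrable_gaussPoly_mul _ _),
    integral_add (integrable_gaussPoly_mul _ _) (integrable_gaussPoly_mul _ _), h]
  ring

/-- The coefficients `√(n / 2)` of the ladder operators. -/
noncomputable def ladderCoeff (n : ℕ) : ℝ := √(n / 2)

theorem ladderCoeff_sq (n : ℕ) : ladderCoeff n ^ 2 = n / 2 := Real.sq_sqrt (by positivity)

theorem ladderCoeff_zero : ladderCoeff 0 = 0 := by simp [ladderCoeff]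

theorem ladderCoeff_nonneg (n : ℕ) : 0 ≤ ladderCoeff n := Real.sqrt_nonneg _

theorem ladderCoeff_succ_pos (n : ℕ) : 0 < ladderCoeff (n + 1) :=
  Real.sqrt_pos.2 (by positivity)

/-- The Hermite polynomials, normalized so that the functions `gaussPoly (hermitePoly n)` are
orthonormal. -/
noncomputable def hermitePoly : ℕ → ℝ[X]
  | 0 => C (√(√Real.pi))⁻¹
  | n + 1 => (2 * ladderCoeff (n + 1))⁻¹ •
      ((2 : ℝ) • (X * hermitePoly n) - derivative (hermitePoly n))

theorem hermitePoly_raise (n : ℕ) :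
    (2 : ℝ) • (X * hermitePoly n) - derivative (hermitePoly n) =
      (2 * ladderCoeff (n + 1)) • hermitePoly (n + 1) := by
  have := ladderCoeff_succ_pos n
  rw [hermitePoly, smul_smul, mul_inv_cancel₀ (by positivity), one_smul]

/-- This is Hermite's differential equation. The lowering relation is a hypothesis so that the
equation is available inside the induction proving that relation. The truncated index `n - 1` at `n
= 0` is harmless because its coefficient vanishes. -/
theorem raise_derivative_hermitePoly {n : ℕ}
    (h : derivative (hermitePoly n) = (2 * ladderCoeff n) • hermitePoly (n - 1)) :
    (2 : ℝ) • (X * derivative (hermitePoly n)) - derivative (derivative (hermitePoly n)) =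
      (2 * n : ℝ) • hermitePoly n := by
  rw [h]
  rcases n with _ | n
  · simp [ladderCoeff_zero]
  · rw [Nat.add_sub_cancel, derivative_smul, mul_smul_comm, smul_comm, ← smul_sub,
      hermitePoly_raise, smul_smul]
    congr 1
    have := ladderCoeff_sq (n + 1)
    push_cast at this ⊢
    linear_combination 4 * this

theorem derivative_hermitePoly (n : ℕ) :
    derivative (hermitePoly n) = (2 * ladderCoeff n) • hermitePoly (n - 1) := by
  induction n with
  | zero => simp [hermitePoly, ladderCoeff_zero]
  | succ n ih =>
    have h1 := raise_derivative_hermitePoly ih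
    have h2 : derivative ((2 : ℝ) • (X * hermitePoly n) - derivative (hermitePoly n)) =
        (2 * (n + 1) : ℝ) • hermitePoly n := by
      rw [derivative_sub, derivative_smul, derivative_mul, derivative_X, one_mul, smul_add,
        add_sub_assoc, h1, ← add_smul]
      congr 1
      ring
    rw [hermitePoly, derivative_smul, h2, smul_smul, Nat.add_sub_cancel]
    congr 1
    have h3 := ladderCoeff_sq (n + 1)
    have h4 := ladderCoeff_succ_pos n
    push_cast at h3
    field_simp
    linear_combination -2 * h3

theorem X_mul_hermitePoly (n : ℕ) :
    X * hermitePoly n =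
      ladderCoeff (n + 1) • hermitePoly (n + 1) + ladderCoeff n • hermitePoly (n - 1) := by
  have h := hermitePoly_raise n
  rw [derivative_hermitePoly, sub_eq_iff_eq_add, mul_smul, mul_smul, ← smul_add] at h
  exact smul_right_injective _ (two_ne_zero : (2 : ℝ) ≠ 0) h

theorem derivative_sub_X_mul_hermitePoly (n : ℕ) :
    derivative (hermitePoly n) - X * hermitePoly n =
      ladderCoeff n • hermitePoly (n - 1) - ladderCoeff (n + 1) • hermitePoly (n + 1) := by
  rw [derivative_hermitePoly, X_mul_hermitePoly]
  module

theorem X_mul_X_mul_hermitePoly (n : ℕ) :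
    X * (X * hermitePoly n) =
      (ladderCoeff (n + 1) * ladderCoeff (n + 2)) • hermitePoly (n + 2) +
        (n + 1 / 2 : ℝ) • hermitePoly n +
        (ladderCoeff n * ladderCoeff (n - 1)) • hermitePoly (n - 2) := by
  have h1 := ladderCoeff_sq n
  have h2 := ladderCoeff_sq (n + 1)
  push_cast at h2
  rw [X_mul_hermitePoly, mul_add, mul_smul_comm, mul_smul_comm, X_mul_hermitePoly,
    X_mul_hermitePoly]
  have h3 : ladderCoeff n • ladderCoeff (n - 1 + 1) • hermitePoly (n - 1 + 1) =
      (n / 2 : ℝ) • hermitePoly n := by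
    rcases n with _ | n
    · simp [ladderCoeff_zero]
    · rw [Nat.add_sub_cancel, smul_smul, ← sq, h1]
  have h4 : (n + 1 / 2 : ℝ) = ladderCoeff (n + 1) ^ 2 + n / 2 := by rw [h2]; ring
  rw [smul_add, smul_add, h3, h4, Nat.add_sub_cancel, Nat.sub_sub]
  module

/-- Moving the raising operator to the other factor, where it becomes a derivative, lowers both
indices by one; the base case is the Gaussian integral. -/
theorem integral_hermitePoly_mul (n m : ℕ) :
    ∫ t, gaussPoly (hermitePoly n) t * gaussPoly (hermitePoly m) t = if n = m then 1 else 0 := by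
  have lower : ∀ n m, ∫ t, gaussPoly (hermitePoly (n + 1)) t * gaussPoly (hermitePoly m) t =
      (ladderCoeff (n + 1))⁻¹ * (ladderCoeff m *
        ∫ t, gaussPoly (hermitePoly n) t * gaussPoly (hermitePoly (m - 1)) t) := by
    intro n m
    have h := integral_gaussPoly_mul_raise (hermitePoly n) (hermitePoly m)
    rw [hermitePoly_raise, derivative_hermitePoly] at h
    simp only [gaussPoly_smul, mul_left_comm (gaussPoly _ _), mul_assoc] at h
    simp only [integral_const_mul] at h
    have := ladderCoeff_succ_pos n
    field_simp
    linarith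
  induction n generalizing m with
  | zero =>
    rcases m with _ | m
    · have h := integral_gaussian 1
      simp only [gaussPoly_mul, hermitePoly, eval_mul, eval_C, if_true, integral_const_mul]
      rw [h, div_one, ← sq, inv_pow, Real.sq_sqrt (Real.sqrt_nonneg _),
        inv_mul_cancel₀ (Real.sqrt_ne_zero'.2 Real.pi_pos)]
    · simp only [mul_comm (gaussPoly (hermitePoly 0) _)]
      rw [lower]
      simp [ladderCoeff_zero]
  | succ n ih =>
    rw [lower, ih]
    rcases m with _ | m
    · simp [ladderCoeff_zero]
    · have := ladderCoeff_succ_pos n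
      by_cases hnm : n = m
      · subst hnm
        simp [this.ne']
      · simp [hnm]

theorem span_range_hermitePoly : Submodule.span ℝ (Set.range hermitePoly) = ⊤ := by
  have hX : ∀ p ∈ Submodule.span ℝ (Set.range hermitePoly),
      X * p ∈ Submodule.span ℝ (Set.range hermitePoly) := by
    intro p hp
    induction hp using Submodule.span_induction with
    | mem x hx =>
      obtain ⟨n, rfl⟩ := hx
      rw [X_mul_hermitePoly]
      exact add_mem (Submodule.smul_mem _ _ (Submodule.subset_span ⟨_, rfl⟩))
        (Submodule.smul_mem _ _ (Submodule.subset_span ⟨_, rfl⟩))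
    | zero => simp
    | add x y _ _ hx hy => rw [mul_add]; exact add_mem hx hy
    | smul a x _ hx => rw [mul_smul_comm]; exact Submodule.smul_mem _ _ hx
  have hpow : ∀ n : ℕ, (X ^ n : ℝ[X]) ∈ Submodule.span ℝ (Set.range hermitePoly) := by
    intro n
    induction n with
    | zero =>
      have h : (1 : ℝ[X]) = √(√Real.pi) • hermitePoly 0 := by
        have : √(√Real.pi) ≠ 0 := (Real.sqrt_pos.2 (Real.sqrt_pos.2 Real.pi_pos)).ne'
        rw [hermitePoly, smul_C, smul_eq_mul, mul_inv_cancel₀ this, C_1]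
      rw [pow_zero, h]
      exact Submodule.smul_mem _ _ (Submodule.subset_span ⟨_, rfl⟩)
    | succ n ih => rw [pow_succ']; exact hX _ ih
  rw [eq_top_iff]
  rintro p -
  rw [p.as_sum_range_C_mul_X_pow]
  refine Submodule.sum_mem _ fun n _ => ?_
  rw [← smul_eq_C_mul]
  exact Submodule.smul_mem _ _ (hpow n)

end HermiteFunctions

/-! ### Completeness of the Hermite functions in `L²(ℝ; W)`. -/

section HermiteBasis

open Polynomial

/-- From `(|c| - |t| / 2)² ≥ 0` one gets `|c t| ≤ c² + t² / 4`, which leaves a Gaussian factor `exp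
(-t² / 4)`. -/
theorem memLp_exp_abs_mul_gaussian (c : ℝ) :
    MemLp (fun t : ℝ => Real.exp |c * t| * Real.exp (-(1 / 2) * t ^ 2)) 2 := by
  have h1 : MemLp (fun t : ℝ => Real.exp (-(1 / 4) * t ^ 2)) 2 := by
    rw [memLp_two_iff_integrable_sq (by fun_prop)]
    have h : ∀ t : ℝ, Real.exp (-(1 / 4) * t ^ 2) ^ 2 = Real.exp (-(1 / 2) * t ^ 2) := fun t => by
      rw [← Real.exp_nat_mul]; push_cast; ring_nf
    simp only [h]
    exact integrable_exp_neg_mul_sq (by norm_num)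
  refine (h1.const_mul (Real.exp (c ^ 2))).mono (by fun_prop) (ae_of_all _ fun t => ?_)
  rw [Real.norm_of_nonneg (by positivity), Real.norm_of_nonneg (by positivity), ← Real.exp_add,
    ← Real.exp_add, Real.exp_le_exp, abs_mul]
  nlinarith [sq_nonneg (|c| - |t| / 2), sq_abs c, sq_abs t]

/-- The moments of an integrable function with exponential decay determine its Fourier
transform. -/
theorem integral_cexp_mul_eq_zero_of_moments {G : ℝ → ℝ} (hG : AEStronglyMeasurable G)
    (hexp : ∀ c : ℝ, Integrable fun t => Real.exp |c * t| * |G t|)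
    (hmom : ∀ n : ℕ, ∫ t, t ^ n * G t = 0) (c : ℝ) :
    ∫ t : ℝ, Complex.exp (c * t * Complex.I) * (G t : ℂ) = 0 := by
  have hterm : ∀ t : ℝ, HasSum (fun n : ℕ => (c * t * Complex.I) ^ n / n.factorial * (G t : ℂ))
      (Complex.exp (c * t * Complex.I) * (G t : ℂ)) := fun t => by
    have := NormedSpace.expSeries_div_hasSum_exp (c * t * Complex.I)
    rw [← Complex.exp_eq_exp_ℂ] at this
    exact this.mul_right _
  have hbound : ∀ t : ℝ, HasSum (fun n : ℕ => |c * t| ^ n / n.factorial * |G t|)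
      (Real.exp |c * t| * |G t|) := fun t => by
    have := NormedSpace.expSeries_div_hasSum_exp |c * t|
    rw [← Real.exp_eq_exp_ℝ] at this
    exact this.mul_right _
  have hG' : AEStronglyMeasurable fun t => (G t : ℂ) :=
    Complex.continuous_ofReal.comp_aestronglyMeasurable hG
  have key := hasSum_integral_of_dominated_convergence (μ := (volume : Measure ℝ))
    (F := fun (n : ℕ) (t : ℝ) => (c * t * Complex.I) ^ n / n.factorial * (G t : ℂ))
    (f := fun t : ℝ => Complex.exp (c * t * Complex.I) * (G t : ℂ))
    (fun n t => |c * t| ^ n / n.factorial * |G t|)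
    (fun n => AEStronglyMeasurable.mul (Continuous.aestronglyMeasurable (by fun_prop)) hG')
    (fun n => ae_of_all _ fun t => by simp [abs_mul])
    (ae_of_all _ fun t => (hbound t).summable)
    (by simpa only [(hbound _).tsum_eq] using hexp c)
    (ae_of_all _ hterm)
  refine key.unique ?_
  have hz : ∀ n : ℕ, ∫ t : ℝ, (c * t * Complex.I) ^ n / n.factorial * (G t : ℂ) = 0 := fun n => by
    have h : ∀ t : ℝ, (c * t * Complex.I) ^ n / n.factorial * (G t : ℂ) =
        ((c * Complex.I) ^ n / n.factorial) * ((t ^ n * G t : ℝ) : ℂ) := fun t => by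
      push_cast; ring
    simp only [h]
    rw [integral_const_mul, integral_complex_ofReal, hmom]
    simp
  simp only [hz]
  exact hasSum_zero

theorem charFun_withDensity_ofReal {G : ℝ → ℝ} (hG : Measurable G) (c : ℝ) :
    charFun (volume.withDensity fun t => ENNReal.ofReal (G t)) c =
      ∫ t : ℝ, Complex.exp (c * t * Complex.I) * ((max (G t) 0 : ℝ) : ℂ) := by
  rw [charFun_apply_real, integral_withDensity_eq_integral_toReal_smul (by fun_prop)
    (ae_of_all _ fun _ => ENNReal.ofReal_lt_top)]
  refine integral_congr_ae (ae_of_all _ fun t => ?_)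
  simp only [ENNReal.toReal_ofReal', Complex.real_smul]
  rw [mul_comm]

/-- The positive and negative parts of `G` are densities of finite measures with the same
characteristic function, hence of the same measure. The two parts then agree almost everywhere,
which forces both to vanish. -/
theorem ae_eq_zero_of_integral_cexp_mul_eq_zero {G : ℝ → ℝ} (hG : Integrable G)
    (hF : ∀ c : ℝ, ∫ t : ℝ, Complex.exp (c * t * Complex.I) * (G t : ℂ) = 0) : G =ᵐ[volume] 0 := by
  wlog hm : Measurable G generalizing G
  · have hGm := hG.aestronglyMeasurable.ae_eq_mk
    refine hGm.trans (this (hG.congr hGm) (fun c => ?_)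
      hG.aestronglyMeasurable.stronglyMeasurable_mk.measurable)
    rw [← hF c]
    refine integral_congr_ae ?_
    filter_upwards [hGm] with t ht
    rw [ht]
  have hfin : ∀ {K : ℝ → ℝ}, Integrable K →
      IsFiniteMeasure (volume.withDensity fun t => ENNReal.ofReal (K t)) := fun hK =>
    isFiniteMeasure_withDensity_ofReal hK.2
  have := hfin hG
  have := hfin hG.neg
  have hexpint : ∀ {K : ℝ → ℝ}, Integrable K → ∀ c : ℝ,
      Integrable fun t : ℝ => Complex.exp (c * t * Complex.I) * ((max (K t) 0 : ℝ) : ℂ) := by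
    intro K hK c
    refine (hK.pos_part.ofReal (𝕜 := ℂ)).bdd_mul (c := 1)
      (Continuous.aestronglyMeasurable (by fun_prop)) (ae_of_all _ fun t => ?_)
    have := Complex.norm_exp_ofReal_mul_I (c * t)
    push_cast at this
    exact this.le
  have hμ : (volume.withDensity fun t => ENNReal.ofReal (G t)) =
      volume.withDensity fun t => ENNReal.ofReal ((-G) t) := by
    refine Measure.ext_of_charFun (funext fun c => ?_)
    rw [charFun_withDensity_ofReal hm, charFun_withDensity_ofReal hm.neg, ← sub_eq_zero,
      ← integral_sub (hexpint hG c) (hexpint hG.neg c), ← hF c]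
    refine integral_congr_ae (ae_of_all _ fun t => ?_)
    simp only [Pi.neg_apply]
    rw [← mul_sub, ← Complex.ofReal_sub]
    congr 2
    rcases le_total (G t) 0 with h | h
    · rw [max_eq_right h, max_eq_left (by linarith)]; ring
    · rw [max_eq_left h, max_eq_right (by linarith)]; ring
  have hae := (withDensity_eq_iff (by fun_prop)
    (by have := hm.neg; fun_prop) (by
      have := hG.2
      rw [hasFiniteIntegral_iff_norm] at this
      refine (lt_of_le_of_lt (lintegral_mono fun t => ?_) this).ne
      exact ENNReal.ofReal_le_ofReal (le_abs_self _))).1 hμ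
  filter_upwards [hae] with t ht
  rcases le_total (G t) 0 with h | h
  · rw [ENNReal.ofReal_of_nonpos h, eq_comm, ENNReal.ofReal_eq_zero, Pi.neg_apply] at ht
    simp only [Pi.zero_apply]; linarith
  · have h' : (-G) t ≤ 0 := by simpa using h
    rw [ENNReal.ofReal_of_nonpos h', ENNReal.ofReal_eq_zero] at ht
    simp only [Pi.zero_apply]; linarith

/-- The product of `f` with the Gaussian has all exponential moments by Cauchy–Schwarz and vanishing
polynomial moments, so its Fourier transform is zero. -/
theorem ae_eq_zero_of_integral_gaussPoly_eq_zero {f : ℝ → ℝ} (hf : MemLp f 2)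
    (h : ∀ p : ℝ[X], ∫ t, gaussPoly p t * f t = 0) : f =ᵐ[volume] 0 := by
  set G : ℝ → ℝ := fun t => Real.exp (-(1 / 2) * t ^ 2) * f t
  have hexp : ∀ c : ℝ, Integrable fun t => Real.exp |c * t| * |G t| := fun c => by
    have := (memLp_exp_abs_mul_gaussian c).integrable_mul hf.norm
    refine this.congr (ae_of_all _ fun t => ?_)
    simp [G, abs_mul, mul_assoc]
  have hGm : AEStronglyMeasurable G :=
    (Continuous.aestronglyMeasurable (by fun_prop)).mul hf.aestronglyMeasurable
  have hG : Integrable G := by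
    have := hexp 0
    simp only [zero_mul, abs_zero, Real.exp_zero, one_mul] at this
    exact (integrable_norm_iff hGm).1 this
  have h0 := ae_eq_zero_of_integral_cexp_mul_eq_zero hG
    (integral_cexp_mul_eq_zero_of_moments hGm hexp fun n => by
      rw [← h (X ^ n)]
      refine integral_congr_ae (ae_of_all _ fun t => ?_)
      simp [G, gaussPoly, mul_assoc])
  filter_upwards [h0] with t ht
  exact (mul_eq_zero.1 ht).resolve_left (Real.exp_pos _).ne'

variable {W : Type*} [NormedAddCommGroup W] [InnerProductSpace ℝ W]

theorem MeasureTheory.MemLp.smul_const {φ : ℝ → ℝ} (hφ : MemLp φ 2) (w : W) :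
    MemLp (fun t => φ t • w) 2 :=
  (hφ.mul_const ‖w‖).of_le_mul (c := 1) (hφ.aestronglyMeasurable.smul_const w)
    (ae_of_all _ fun t => by simp [norm_smul])

/-- The element `φ(t) w` of `L²(ℝ; W)`. -/
noncomputable def tensorL2 {φ : ℝ → ℝ} (hφ : MemLp φ 2) (w : W) : L2Line W :=
  (hφ.smul_const w).toLp

theorem coeFn_tensorL2 {φ : ℝ → ℝ} (hφ : MemLp φ 2) (w : W) :
    tensorL2 hφ w =ᵐ[volume] fun t => φ t • w :=
  MemLp.coeFn_toLp _

theorem inner_tensorL2 {φ : ℝ → ℝ} (hφ : MemLp φ 2) (w : W) (u : L2Line W) :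
    ⟪tensorL2 hφ w, u⟫_ℝ = ∫ t, φ t * ⟪w, u t⟫_ℝ := by
  rw [L2.inner_def]
  refine integral_congr_ae ?_
  filter_upwards [coeFn_tensorL2 hφ w] with t ht
  rw [ht, real_inner_smul_left]

/-- The element `p(t) exp (-t² / 2) w` of `L²(ℝ; W)`, as a linear function of `p`. -/
noncomputable def gaussL2 (w : W) : ℝ[X] →ₗ[ℝ] L2Line W where
  toFun p := tensorL2 (memLp_gaussPoly p) w
  map_add' p q := by
    rw [tensorL2, tensorL2, tensorL2, ← MemLp.toLp_add]
    congr 1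
    ext t
    simp [gaussPoly_add, add_smul]
  map_smul' a p := by
    rw [tensorL2, tensorL2, RingHom.id_apply, ← MemLp.toLp_const_smul]
    congr 1
    ext t
    simp [gaussPoly_smul, mul_smul]

theorem coeFn_gaussL2 (w : W) (p : ℝ[X]) :
    gaussL2 w p =ᵐ[volume] fun t => gaussPoly p t • w :=
  coeFn_tensorL2 (memLp_gaussPoly p) w

theorem inner_gaussL2 (w : W) (p : ℝ[X]) (u : L2Line W) :
    ⟪gaussL2 w p, u⟫_ℝ = ∫ t, gaussPoly p t * ⟪w, u t⟫_ℝ :=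
  inner_tensorL2 (memLp_gaussPoly p) w u

variable [FiniteDimensional ℝ W]

variable (W) in
/-- The family of `W`-valued Hermite functions. -/
noncomputable def hermiteL2 (i : ℕ × Fin (Module.finrank ℝ W)) : L2Line W :=
  gaussL2 (stdOrthonormalBasis ℝ W i.2) (hermitePoly i.1)

theorem orthonormal_hermiteL2 : Orthonormal ℝ (hermiteL2 W) := by
  classical
  rw [orthonormal_iff_ite]
  rintro ⟨n, i⟩ ⟨m, j⟩
  have h : ⟪hermiteL2 W (n, i), hermiteL2 W (m, j)⟫_ℝ =
      (∫ t, gaussPoly (hermitePoly n) t * gaussPoly (hermitePoly m) t) *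
        ⟪stdOrthonormalBasis ℝ W i, stdOrthonormalBasis ℝ W j⟫_ℝ := by
    rw [hermiteL2, inner_gaussL2, ← integral_mul_const]
    refine integral_congr_ae ?_
    filter_upwards [coeFn_gaussL2 (stdOrthonormalBasis ℝ W j) (hermitePoly m)] with t ht
    rw [hermiteL2, ht, real_inner_smul_right]
    ring
  rw [h, integral_hermitePoly_mul, orthonormal_iff_ite.1 (stdOrthonormalBasis ℝ W).orthonormal]
  by_cases h1 : n = m <;> by_cases h2 : i = j <;> simp [h1, h2]

theorem eq_zero_of_inner_hermiteL2_eq_zero {u : L2Line W}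
    (hu : ∀ i, ⟪hermiteL2 W i, u⟫_ℝ = 0) : u = 0 := by
  have h1 : ∀ (j : Fin (Module.finrank ℝ W)) (p : ℝ[X]),
      ⟪gaussL2 (stdOrthonormalBasis ℝ W j) p, u⟫_ℝ = 0 := by
    intro j p
    have hp : p ∈ Submodule.span ℝ (Set.range hermitePoly) := by
      rw [span_range_hermitePoly]; trivial
    induction hp using Submodule.span_induction with
    | mem x hx =>
      obtain ⟨n, rfl⟩ := hx
      exact hu (n, j)
    | zero => simp
    | add x y _ _ hx hy => rw [map_add, inner_add_left, hx, hy, add_zero]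
    | smul a x _ hx => rw [map_smul, real_inner_smul_left, hx, mul_zero]
  have h2 : ∀ j, (fun t => ⟪stdOrthonormalBasis ℝ W j, u t⟫_ℝ) =ᵐ[volume] 0 := fun j =>
    ae_eq_zero_of_integral_gaussPoly_eq_zero ((Lp.memLp u).const_inner _) fun p => by
      rw [← inner_gaussL2, h1]
  rw [Lp.eq_zero_iff_ae_eq_zero]
  filter_upwards [ae_all_iff.2 h2] with t ht
  apply (stdOrthonormalBasis ℝ W).repr.injective
  ext j
  simpa [OrthonormalBasis.repr_apply_apply] using ht j

variable (W) in
/-- The Hilbert basis of `L²(ℝ; W)` consisting of the Hermite functions. -/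
noncomputable def hermiteBasis :
    HilbertBasis (ℕ × Fin (Module.finrank ℝ W)) ℝ (L2Line W) :=
  HilbertBasis.mkOfOrthogonalEqBot orthonormal_hermiteL2 (by
    rw [Submodule.eq_bot_iff]
    intro u hu
    refine eq_zero_of_inner_hermiteL2_eq_zero fun i => ?_
    exact (Submodule.mem_orthogonal _ _).1 hu _ (Submodule.subset_span ⟨i, rfl⟩))

theorem hermiteBasis_apply (i : ℕ × Fin (Module.finrank ℝ W)) :
    hermiteBasis W i = gaussL2 (stdOrthonormalBasis ℝ W i.2) (hermitePoly i.1) := by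
  rw [hermiteBasis, HilbertBasis.coe_mkOfOrthogonalEqBot, hermiteL2]

end HermiteBasis

/-! ### Closed graphs of the weak derivative and of multiplication by the coordinate. -/

section ClosedRelations

variable {W : Type*} [NormedAddCommGroup W] [InnerProductSpace ℝ W]

theorem integrable_smul_L2 {φ : ℝ → ℝ} (hφ : MemLp φ 2) (u : L2Line W) :
    Integrable fun t => φ t • u t :=
  memLp_one_iff_integrable.1 ((Lp.memLp u).smul hφ)

theorem inner_tensorL2_eq_inner_integral [CompleteSpace W] {φ : ℝ → ℝ} (hφ : MemLp φ 2) (w : W)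
    (u : L2Line W) : ⟪tensorL2 hφ w, u⟫_ℝ = ⟪w, ∫ t, φ t • u t⟫_ℝ := by
  rw [inner_tensorL2, ← integral_inner (integrable_smul_L2 hφ u)]
  simp only [real_inner_smul_right]

theorem memLp_of_contDiff_hasCompactSupport {φ : ℝ → ℝ} (h : ContDiff ℝ ∞ φ)
    (hc : HasCompactSupport φ) : MemLp φ 2 :=
  h.continuous.memLp_of_hasCompactSupport hc

theorem memLp_deriv_of_contDiff_hasCompactSupport {φ : ℝ → ℝ} (h : ContDiff ℝ ∞ φ)
    (hc : HasCompactSupport φ) : MemLp (deriv φ) 2 :=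
  (h.continuous_deriv (by simp)).memLp_of_hasCompactSupport hc.deriv

/-- In this form the condition is an equality of continuous linear functionals of `u` and `v`, from
which linearity and closedness of the graph follow at once. -/
theorem isWeakDeriv_iff_inner [CompleteSpace W] {u v : L2Line W} :
    IsWeakDeriv u v ↔ ∀ (φ : ℝ → ℝ) (h : ContDiff ℝ ∞ φ) (hc : HasCompactSupport φ) (w : W),
      ⟪tensorL2 (memLp_deriv_of_contDiff_hasCompactSupport h hc) w, u⟫_ℝ =
        -⟪tensorL2 (memLp_of_contDiff_hasCompactSupport h hc) w, v⟫_ℝ := by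
  simp only [inner_tensorL2_eq_inner_integral, ← inner_neg_right]
  refine forall_congr' fun φ => forall_congr' fun h => forall_congr' fun hc => ?_
  exact ⟨fun h w => by rw [h], fun h => ext_inner_left ℝ h⟩

variable (W) in
/-- The graph of the weak derivative. -/
def weakDerivGraph [CompleteSpace W] : Submodule ℝ (L2Line W × L2Line W) where
  carrier := {x | IsWeakDeriv x.1 x.2}
  zero_mem' := by
    simp only [Set.mem_ofPred_eq, isWeakDeriv_iff_inner]
    simp
  add_mem' {x y} hx hy := by
    simp only [Set.mem_ofPred_eq, isWeakDeriv_iff_inner] at hx hy ⊢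
    intro φ h hc w
    simp only [Prod.fst_add, Prod.snd_add, inner_add_right, hx φ h hc w, hy φ h hc w]
    ring
  smul_mem' a x hx := by
    simp only [Set.mem_ofPred_eq, isWeakDeriv_iff_inner] at hx ⊢
    intro φ h hc w
    simp only [Prod.smul_fst, Prod.smul_snd, real_inner_smul_right, hx φ h hc w]
    ring

theorem isClosed_weakDerivGraph [CompleteSpace W] :
    IsClosed (weakDerivGraph W : Set (L2Line W × L2Line W)) := by
  change IsClosed {x : L2Line W × L2Line W | IsWeakDeriv x.1 x.2}
  simp only [isWeakDeriv_iff_inner, Set.ofPred_forall]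
  refine isClosed_iInter fun φ => isClosed_iInter fun h => isClosed_iInter fun hc =>
    isClosed_iInter fun w => isClosed_eq (by fun_prop) (by fun_prop)

variable (W) in
/-- The graph of the multiplication by the coordinate. -/
def mulGraph : Submodule ℝ (L2Line W × L2Line W) where
  carrier := {x | ∀ᵐ t : ℝ, x.2 t = t • x.1 t}
  zero_mem' := by
    filter_upwards [Lp.coeFn_zero W 2 (volume : Measure ℝ)] with t ht
    simp only [Prod.fst_zero, Prod.snd_zero, ht, Pi.zero_apply, smul_zero]
  add_mem' {x y} hx hy := by
    filter_upwards [hx, hy, Lp.coeFn_add x.1 y.1, Lp.coeFn_add x.2 y.2] with t h1 h2 h3 h4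
    simp only [Prod.fst_add, Prod.snd_add, h3, h4, Pi.add_apply, h1, h2, smul_add]
  smul_mem' a x hx := by
    filter_upwards [hx, Lp.coeFn_smul a x.1, Lp.coeFn_smul a x.2] with t h1 h2 h3
    simp only [Prod.smul_fst, Prod.smul_snd, h2, h3, Pi.smul_apply, h1, smul_comm a]

theorem isClosed_mulGraph : IsClosed (mulGraph W : Set (L2Line W × L2Line W)) := by
  refine IsSeqClosed.isClosed fun x y hx hxy => ?_
  have h1 := tendstoInMeasure_of_tendsto_Lp ((continuous_fst.tendsto y).comp hxy)
  obtain ⟨ns, hns, h1⟩ := h1.exists_seq_tendsto_ae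
  -- The second subsequence is extracted from the first, so that both components converge almost
  -- everywhere along it.
  have h2 := tendstoInMeasure_of_tendsto_Lp
    (((continuous_snd.tendsto y).comp hxy).comp hns.tendsto_atTop)
  obtain ⟨ms, hms, h2⟩ := h2.exists_seq_tendsto_ae
  have h3 : ∀ᵐ t : ℝ, ∀ n, (x n).2 t = t • (x n).1 t := ae_all_iff.2 hx
  change ∀ᵐ t : ℝ, y.2 t = t • y.1 t
  filter_upwards [h1, h2, h3] with t h1 h2 h3
  refine tendsto_nhds_unique h2 ?_
  simp only [Function.comp_apply, h3]
  exact (h1.comp hms.tendsto_atTop).const_smul t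

/-- Transfers a closed linear relation, such as the graph of an unbounded operator, from basis
vectors to the whole space when both components are bounded operators. -/
theorem HilbertBasis.forall_mem_of_isClosed {ι E F : Type*} [NormedAddCommGroup E]
    [InnerProductSpace ℝ E] [NormedAddCommGroup F] [InnerProductSpace ℝ F]
    (b : HilbertBasis ι ℝ E) {G : Submodule ℝ (F × F)} (hG : IsClosed (G : Set (F × F)))
    {S T : E →L[ℝ] F} (h : ∀ i, (S (b i), T (b i)) ∈ G) (x : E) : (S x, T x) ∈ G := by
  have hc : IsClosed (G.comap (S.prod T).toLinearMap : Set E) :=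
    hG.preimage (S.prod T).continuous
  have hs : Submodule.span ℝ (Set.range b) ≤ G.comap (S.prod T).toLinearMap := by
    rw [Submodule.span_le]
    rintro _ ⟨i, rfl⟩
    exact h i
  have := closure_minimal hs hc (b.dense_span_range x)
  exact this

open Polynomial

theorem mulGraph_gaussL2 (w : W) (p : ℝ[X]) : (gaussL2 w p, gaussL2 w (X * p)) ∈ mulGraph W := by
  change ∀ᵐ t : ℝ, gaussL2 w (X * p) t = t • gaussL2 w p t
  filter_upwards [coeFn_gaussL2 w p, coeFn_gaussL2 w (X * p)] with t h1 h2
  rw [h1, h2, gaussPoly_X_mul, mul_smul]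

theorem weakDerivGraph_gaussL2 [CompleteSpace W] (w : W) (p : ℝ[X]) :
    (gaussL2 w p, gaussL2 w (derivative p - X * p)) ∈ weakDerivGraph W := by
  intro φ h hc
  have hφ := memLp_of_contDiff_hasCompactSupport h hc
  have hφ' := memLp_deriv_of_contDiff_hasCompactSupport h hc
  have h1 := integral_mul_deriv_eq_deriv_mul_of_integrable (u := gaussPoly p) (v := φ)
    (fun x _ => hasDerivAt_gaussPoly p x)
    (fun x _ => (h.differentiable (by simp) x).hasDerivAt)
    ((memLp_gaussPoly p).integrable_mul hφ') ((memLp_gaussPoly _).integrable_mul hφ)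
    ((memLp_gaussPoly p).integrable_mul hφ)
  have h2 : ∀ (ψ : ℝ → ℝ) (q : ℝ[X]),
      ∫ x, ψ x • gaussL2 w q x = (∫ x, gaussPoly q x * ψ x) • w := by
    intro ψ q
    rw [← integral_smul_const]
    refine integral_congr_ae ?_
    filter_upwards [coeFn_gaussL2 w q] with t ht
    rw [ht, smul_smul, mul_comm]
  simp only
  rw [h2, h2, h1, neg_smul]

/-- The weak derivative may be tested against functions `p(t) exp (-t² / 2)`. -/
theorem IsWeakDeriv.inner_gaussL2 [CompleteSpace W] {u v : L2Line W} (huv : IsWeakDeriv u v)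
    (w : W) (p : ℝ[X]) :
    ⟪gaussL2 w (derivative p - X * p), u⟫_ℝ = -⟪gaussL2 w p, v⟫_ℝ := by
  -- The Gaussian function is cut off by `χ (r k * t)` with `r k → 0`. The extra derivative term
  -- carries a factor `r k`, so it disappears in the limit by dominated convergence.
  let χ : ContDiffBump (0 : ℝ) := ⟨1, 2, one_pos, one_lt_two⟩
  have hχ : ContDiff ℝ ∞ χ := χ.contDiff
  have hχd : ∀ x, HasDerivAt χ (deriv χ x) x := fun x =>
    (hχ.differentiable (by simp) x).hasDerivAt
  obtain ⟨C, hC⟩ := (hχ.continuous_deriv (by simp)).bounded_above_of_compact_support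
    χ.hasCompactSupport.deriv
  let r : ℕ → ℝ := fun k => 1 / ((k : ℝ) + 1)
  have hr0 : ∀ k, 0 < r k := fun k => by positivity
  have hr1 : ∀ k, r k ≤ 1 := fun k => by
    rw [div_le_one (by positivity)]
    linarith [(Nat.cast_nonneg k : (0 : ℝ) ≤ k)]
  have hr : Filter.Tendsto r Filter.atTop (nhds 0) := tendsto_one_div_add_atTop_nhds_zero_nat
  have hrt : ∀ t : ℝ, Filter.Tendsto (fun k => r k * t) Filter.atTop (nhds 0) := fun t => by
    simpa using hr.mul_const t
  let φ : ℕ → ℝ → ℝ := fun k t => χ (r k * t) * gaussPoly p t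
  have hφ : ∀ k, ContDiff ℝ ∞ (φ k) := fun k =>
    (hχ.comp (contDiff_const.mul contDiff_id)).mul (contDiff_gaussPoly p)
  have hφc : ∀ k, HasCompactSupport (φ k) := fun k => by
    have : HasCompactSupport fun t => χ (r k * t) := by
      have := χ.hasCompactSupport.comp_homeomorph (Homeomorph.mulLeft₀ (r k) (hr0 k).ne')
      exact this
    exact this.mul_right
  set q := derivative p - X * p
  have hφd : ∀ k t, deriv (φ k) t =
      r k * deriv χ (r k * t) * gaussPoly p t + χ (r k * t) * gaussPoly q t := fun k t => by
    have h1 : HasDerivAt (fun t => χ (r k * t)) (r k * deriv χ (r k * t)) t := by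
      have h2 : HasDerivAt (fun t => r k * t) (r k) t := by
        simpa using (hasDerivAt_id t).const_mul (r k)
      have := (hχd (r k * t)).comp t h2
      rwa [mul_comm] at this
    exact (h1.mul (hasDerivAt_gaussPoly p t)).deriv
  have htest : ∀ k, ∫ t, deriv (φ k) t * ⟪w, u t⟫_ℝ = -∫ t, φ k t * ⟪w, v t⟫_ℝ := fun k => by
    have := isWeakDeriv_iff_inner.1 huv (φ k) (hφ k) (hφc k) w
    rwa [inner_tensorL2, inner_tensorL2] at this
  have hu : MemLp (fun t => ⟪w, u t⟫_ℝ) 2 := (Lp.memLp u).const_inner w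
  have hv : MemLp (fun t => ⟪w, v t⟫_ℝ) 2 := (Lp.memLp v).const_inner w
  have hχ1 : ∀ x, |χ x| ≤ 1 := fun x => by
    rw [abs_of_nonneg χ.nonneg]; exact χ.le_one
  have hχt : ∀ t : ℝ, Filter.Tendsto (fun k => χ (r k * t)) Filter.atTop (nhds 1) := fun t => by
    have h0 : χ 0 = 1 := χ.one_of_mem_closedBall (by simp [χ])
    rw [← h0]
    exact (hχ.continuous.tendsto 0).comp (hrt t)
  have hlim2 : Filter.Tendsto (fun k => ∫ t, φ k t * ⟪w, v t⟫_ℝ) Filter.atTop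
      (nhds (∫ t, gaussPoly p t * ⟪w, v t⟫_ℝ)) := by
    refine tendsto_integral_of_dominated_convergence (fun t => ‖gaussPoly p t * ⟪w, v t⟫_ℝ‖)
      (fun k => (hφ k).continuous.aestronglyMeasurable.mul hv.aestronglyMeasurable)
      ((memLp_gaussPoly p).integrable_mul hv).norm
      (fun k => ae_of_all _ fun t => ?_) (ae_of_all _ fun t => ?_)
    · simp only [φ, mul_assoc]
      rw [norm_mul]
      exact mul_le_of_le_one_left (norm_nonneg _) (hχ1 _)
    · have := ((hχt t).mul_const (gaussPoly p t)).mul_const ⟪w, v t⟫_ℝ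
      simpa only [one_mul] using this
  have hlim1 : Filter.Tendsto (fun k => ∫ t, deriv (φ k) t * ⟪w, u t⟫_ℝ) Filter.atTop
      (nhds (∫ t, gaussPoly q t * ⟪w, u t⟫_ℝ)) := by
    refine tendsto_integral_of_dominated_convergence
      (fun t => C * ‖gaussPoly p t * ⟪w, u t⟫_ℝ‖ + ‖gaussPoly q t * ⟪w, u t⟫_ℝ‖)
      (fun k => ((hφ k).continuous_deriv (by simp)).aestronglyMeasurable.mul
        hu.aestronglyMeasurable)
      ((((memLp_gaussPoly p).integrable_mul hu).norm.const_mul C).add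
        ((memLp_gaussPoly q).integrable_mul hu).norm)
      (fun k => ae_of_all _ fun t => ?_) (ae_of_all _ fun t => ?_)
    · rw [hφd, add_mul, mul_assoc, mul_assoc (χ (r k * t))]
      refine (norm_add_le _ _).trans (add_le_add ?_ ?_)
      · rw [norm_mul, norm_mul]
        refine mul_le_mul_of_nonneg_right ?_ (norm_nonneg _)
        rw [Real.norm_of_nonneg (hr0 k).le]
        exact (mul_le_of_le_one_left (norm_nonneg _) (hr1 k)).trans (hC _)
      · rw [norm_mul]
        exact mul_le_of_le_one_left (norm_nonneg _) (hχ1 _)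
    · simp only [hφd]
      have h1 : Filter.Tendsto (fun k => r k * deriv χ (r k * t)) Filter.atTop (nhds 0) := by
        have := hr.mul (((hχ.continuous_deriv (by simp)).tendsto 0).comp (hrt t))
        simpa using this
      have := ((h1.mul_const (gaussPoly p t)).add ((hχt t).mul_const (gaussPoly q t))).mul_const
        ⟪w, u t⟫_ℝ
      simpa using this
  rw [_root_.inner_gaussL2, _root_.inner_gaussL2]
  refine tendsto_nhds_unique hlim1 ?_
  simp only [htest]
  exact hlim2.neg

end ClosedRelations

/-! ### The harmonic oscillator, its inverse and the dual norm. -/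

section HarmonicOscillator

open Polynomial

variable {W : Type*} [NormedAddCommGroup W] [InnerProductSpace ℝ W] [FiniteDimensional ℝ W]

variable (W) in
-- A weighted shift. Injectivity of `σ` is asked only where the weight is nonzero, since the
-- truncated shifts `n - 1` and `n - 2` merge low indices whose weights vanish.
theorem exists_clm_hermiteBasis {α : ℕ → ℝ} {σ : ℕ → ℕ} {C : ℝ} (hα : ∀ n, |α n| ≤ C)
    (hσ : ∀ n m, α n ≠ 0 → α m ≠ 0 → σ n = σ m → n = m) :
    ∃ T : L2Line W →L[ℝ] L2Line W,
      ∀ n j, T (hermiteBasis W (n, j)) = α n • hermiteBasis W (σ n, j) := by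
  have ho := (hermiteBasis W).orthonormal
  obtain ⟨T, hT⟩ := (hermiteBasis W).exists_clm_of_orthogonal
    (w := fun i => α i.1 • hermiteBasis W (σ i.1, i.2)) (C := C) (by
      rintro ⟨n, i⟩ ⟨m, j⟩ hne
      rw [real_inner_smul_left, real_inner_smul_right]
      by_cases hn : α n = 0
      · simp [hn]
      by_cases hm : α m = 0
      · simp [hm]
      rw [ho.2, mul_zero, mul_zero]
      intro h
      obtain ⟨h1, h2⟩ := Prod.mk.inj h
      exact hne (Prod.ext (hσ n m hn hm h1) h2)) (by
      rintro ⟨n, i⟩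
      rw [norm_smul, ho.1, mul_one]
      exact hα n)
  exact ⟨T, fun n j => hT (n, j)⟩

/-- The eigenvalue equation `h'' = (t² - (2n + 1)) h` for the Hermite functions, read on polynomial
factors. -/
theorem second_derivative_hermitePoly (n : ℕ) :
    derivative (derivative (hermitePoly n) - X * hermitePoly n) -
        X * (derivative (hermitePoly n) - X * hermitePoly n) =
      X * (X * hermitePoly n) - (2 * n + 1 : ℝ) • hermitePoly n := by
  have h1 := raise_derivative_hermitePoly (derivative_hermitePoly n)
  rw [add_smul, ← h1, derivative_sub, derivative_mul, derivative_X, one_mul, one_smul,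
    mul_sub, two_smul]
  module

variable (W) in
/-- The bounded operators `K`, `Q = t K`, `M = t² K` and `D = d/dt K`, where `K` is the inverse of
the harmonic oscillator, described by their action on the Hermite functions. -/
theorem exists_operators_hermiteBasis :
    ∃ K Q M D : L2Line W →L[ℝ] L2Line W,
      (∀ i, K (hermiteBasis W i) = gaussL2 (stdOrthonormalBasis ℝ W i.2)
        ((i.1 + 1 / 2 : ℝ)⁻¹ • hermitePoly i.1)) ∧
      (∀ i, Q (hermiteBasis W i) = gaussL2 (stdOrthonormalBasis ℝ W i.2)
        ((i.1 + 1 / 2 : ℝ)⁻¹ • (X * hermitePoly i.1))) ∧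
      (∀ i, M (hermiteBasis W i) = gaussL2 (stdOrthonormalBasis ℝ W i.2)
        ((i.1 + 1 / 2 : ℝ)⁻¹ • (X * (X * hermitePoly i.1)))) ∧
      (∀ i, D (hermiteBasis W i) = gaussL2 (stdOrthonormalBasis ℝ W i.2)
        ((i.1 + 1 / 2 : ℝ)⁻¹ • (derivative (hermitePoly i.1) - X * hermitePoly i.1))) := by
  have pos : ∀ n : ℕ, (0 : ℝ) < n + 1 / 2 := fun n => by positivity
  have bound : ∀ {x : ℝ} {n : ℕ}, 0 ≤ x → x ≤ 2 * (n + 1 / 2) →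
      |(n + 1 / 2 : ℝ)⁻¹ * x| ≤ 2 := fun {x n} h0 h => by
    have := pos n
    rw [abs_of_nonneg (by positivity), inv_mul_le_iff₀ this]
    linarith
  have hn0 : ∀ n : ℕ, (0 : ℝ) ≤ n := fun n => n.cast_nonneg
  have sub_le : ∀ n : ℕ, ((n - 1 : ℕ) : ℝ) ≤ n := fun n => by exact_mod_cast n.sub_le 1
  have nz : ∀ n : ℕ, (n + 1 / 2 : ℝ)⁻¹ * ladderCoeff n ≠ 0 → n ≠ 0 := by
    rintro _ h rfl
    simp [ladderCoeff_zero] at h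
  obtain ⟨K, hK⟩ := exists_clm_hermiteBasis W (α := fun n => (n + 1 / 2 : ℝ)⁻¹ * 1) (σ := id)
    (C := 2) (fun n => bound zero_le_one (by linarith [hn0 n])) fun n m _ _ h => h
  obtain ⟨A, hA⟩ := exists_clm_hermiteBasis W
    (α := fun n => (n + 1 / 2 : ℝ)⁻¹ * ladderCoeff (n + 1)) (σ := fun n => n + 1) (C := 2)
    (fun n => bound (ladderCoeff_nonneg _) (by
      have h := ladderCoeff_sq (n + 1)
      push_cast at h
      nlinarith [hn0 n, ladderCoeff_nonneg (n + 1)])) fun n m _ _ h => by simpa using h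
  obtain ⟨B, hB⟩ := exists_clm_hermiteBasis W
    (α := fun n => (n + 1 / 2 : ℝ)⁻¹ * ladderCoeff n) (σ := fun n => n - 1) (C := 2)
    (fun n => bound (ladderCoeff_nonneg _) (by
      have h := ladderCoeff_sq n
      nlinarith [hn0 n, ladderCoeff_nonneg n])) fun n m hn hm h => by
      have := nz n hn
      have := nz m hm
      omega
  obtain ⟨A2, hA2⟩ := exists_clm_hermiteBasis W
    (α := fun n => (n + 1 / 2 : ℝ)⁻¹ * (ladderCoeff (n + 1) * ladderCoeff (n + 2)))
    (σ := fun n => n + 2) (C := 2)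
    (fun n => bound (mul_nonneg (ladderCoeff_nonneg _) (ladderCoeff_nonneg _)) (by
      have h := ladderCoeff_sq (n + 1)
      have h' := ladderCoeff_sq (n + 2)
      push_cast at h h'
      nlinarith [hn0 n, sq_nonneg (ladderCoeff (n + 1) - ladderCoeff (n + 2))]))
    fun n m _ _ h => by simpa using h
  obtain ⟨B2, hB2⟩ := exists_clm_hermiteBasis W
    (α := fun n => (n + 1 / 2 : ℝ)⁻¹ * (ladderCoeff n * ladderCoeff (n - 1)))
    (σ := fun n => n - 2) (C := 2)
    (fun n => bound (mul_nonneg (ladderCoeff_nonneg _) (ladderCoeff_nonneg _)) (by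
      have h := ladderCoeff_sq n
      have h' := ladderCoeff_sq (n - 1)
      nlinarith [hn0 n, sub_le n, sq_nonneg (ladderCoeff n - ladderCoeff (n - 1))]))
    fun n m hn hm h => by
      have key : ∀ k : ℕ,
          (k + 1 / 2 : ℝ)⁻¹ * (ladderCoeff k * ladderCoeff (k - 1)) ≠ 0 → 2 ≤ k := by
        intro k hk
        by_contra! hlt
        interval_cases k <;> simp [ladderCoeff_zero] at hk
      have := key n hn
      have := key m hm
      omega
  simp only [hermiteBasis_apply, ← map_smul] at hK hA hB hA2 hB2
  -- The diagonal part of `t² K` is the identity: the coefficient `n + 1/2` in `X² h_n` cancels the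
  -- eigenvalue of `K`.
  refine ⟨K, A + B, A2 + ContinuousLinearMap.id ℝ _ + B2, B - A, fun i => ?_, fun i => ?_,
    fun i => ?_, fun i => ?_⟩
  · rw [hermiteBasis_apply, hK, mul_one]
    rfl
  · rw [hermiteBasis_apply, add_apply, hA, hB, ← map_add, X_mul_hermitePoly, smul_add,
      smul_smul, smul_smul]
  · have := (pos i.1).ne'
    rw [hermiteBasis_apply, add_apply, add_apply, hA2, hB2, ContinuousLinearMap.id_apply,
      ← map_add, ← map_add, X_mul_X_mul_hermitePoly, smul_add, smul_add, smul_smul, smul_smul,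
      smul_smul, inv_mul_cancel₀ this, one_smul]
  · rw [hermiteBasis_apply, sub_apply, hA, hB, ← map_sub, derivative_sub_X_mul_hermitePoly,
      smul_sub, smul_smul, smul_smul]

/-- The inverse `K` of the harmonic oscillator, together with the bounded operator `Q = t K`. -/
theorem exists_harmonicOscillator_inverse [CompleteSpace W] :
    ∃ K Q : L2Line W →L[ℝ] L2Line W,
      (∀ i, K (hermiteBasis W i) = (i.1 + 1 / 2 : ℝ)⁻¹ • hermiteBasis W i) ∧
      (∀ h, ∀ᵐ t : ℝ, Q h t = t • K h t) ∧ ∀ h, HarmonicOscillatorGraph (K h) h := by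
  obtain ⟨K, Q, M, D, hKb, hQb, hMb, hDb⟩ := exists_operators_hermiteBasis W
  have hKQ : ∀ h, (K h, Q h) ∈ mulGraph W :=
    (hermiteBasis W).forall_mem_of_isClosed (F := L2Line W) (G := mulGraph W)
      isClosed_mulGraph fun i => by
      rw [hKb, hQb, ← mul_smul_comm _ X (hermitePoly i.1)]
      exact mulGraph_gaussL2 _ _
  have hQM : ∀ h, (Q h, M h) ∈ mulGraph W :=
    (hermiteBasis W).forall_mem_of_isClosed (F := L2Line W) (G := mulGraph W)
      isClosed_mulGraph fun i => by
      rw [hQb, hMb, ← mul_smul_comm _ X (X * hermitePoly i.1)]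
      exact mulGraph_gaussL2 _ _
  have hKD : ∀ h, (K h, D h) ∈ weakDerivGraph W :=
    (hermiteBasis W).forall_mem_of_isClosed (F := L2Line W) (G := weakDerivGraph W)
      isClosed_weakDerivGraph fun i => by
      have h := weakDerivGraph_gaussL2 (stdOrthonormalBasis ℝ W i.2)
        ((i.1 + 1 / 2 : ℝ)⁻¹ • hermitePoly i.1)
      rw [derivative_smul, mul_smul_comm, ← smul_sub] at h
      rw [hKb, hDb]
      exact h
  -- This is `(K h)'' = t² K h - 2 h`, the equation `A K h = h` solved for the second derivative.
  have hDM : ∀ h, (D h, (M - (2 : ℝ) • ContinuousLinearMap.id ℝ (L2Line W)) h) ∈ weakDerivGraph W :=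
    (hermiteBasis W).forall_mem_of_isClosed (F := L2Line W) (G := weakDerivGraph W)
      isClosed_weakDerivGraph fun i => by
      have h := weakDerivGraph_gaussL2 (stdOrthonormalBasis ℝ W i.2)
        ((i.1 + 1 / 2 : ℝ)⁻¹ • (derivative (hermitePoly i.1) - X * hermitePoly i.1))
      rw [derivative_smul, mul_smul_comm, ← smul_sub, second_derivative_hermitePoly] at h
      have e : (i.1 + 1 / 2 : ℝ)⁻¹ * (2 * i.1 + 1) = 2 := by
        have : (i.1 + 1 / 2 : ℝ) ≠ 0 := by positivity
        field_simp
      rw [smul_sub _ (X * (X * _)), smul_smul, e] at h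
      rw [hDb, sub_apply, hMb, smul_apply, ContinuousLinearMap.id_apply, hermiteBasis_apply,
        ← map_smul, ← map_sub]
      exact h
  refine ⟨K, Q, fun i => ?_, hKQ, fun h => ⟨?_, D h, _, hKD h, hDM h, ?_⟩⟩
  · rw [hKb, hermiteBasis_apply, map_smul]
  · refine (Lp.memLp (K h + M h)).ae_eq ?_
    filter_upwards [Lp.coeFn_add (K h) (M h), hKQ h, hQM h] with t h1 h2 h3
    rw [h1, Pi.add_apply, h3, h2, smul_smul, add_smul, one_smul, sq]
  · have e : (M - (2 : ℝ) • ContinuousLinearMap.id ℝ (L2Line W)) h = M h - (2 : ℝ) • h := rfl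
    filter_upwards [Lp.coeFn_sub (M h) ((2 : ℝ) • h), Lp.coeFn_smul (2 : ℝ) h, hKQ h, hQM h]
      with t h1 h2 h3 h4
    rw [e, h1, Pi.sub_apply, h2, h4, h3, Pi.smul_apply]
    module

/-- The Hermite coefficients of `A v` in terms of those of `v`. -/
theorem HarmonicOscillatorGraph.inner_hermiteBasis [CompleteSpace W] {v f : L2Line W}
    (h : HarmonicOscillatorGraph v f) (i : ℕ × Fin (Module.finrank ℝ W)) :
    ⟪hermiteBasis W i, f⟫_ℝ = (i.1 + 1 / 2 : ℝ) * ⟪hermiteBasis W i, v⟫_ℝ := by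
  obtain ⟨hm, u', u'', h1, h2, hf⟩ := h
  rw [hermiteBasis_apply]
  have hm2 : MemLp (fun t : ℝ => t ^ 2 • v t) 2 := by
    refine (hm.sub (Lp.memLp v)).ae_eq (ae_of_all _ fun t => ?_)
    simp [add_smul]
  have hfe : f = -((1 / 2 : ℝ) • u'') + (1 / 2 : ℝ) • hm2.toLp := by
    refine Lp.ext ?_
    filter_upwards [hf, Lp.coeFn_add (-((1 / 2 : ℝ) • u'')) ((1 / 2 : ℝ) • hm2.toLp),
      Lp.coeFn_neg ((1 / 2 : ℝ) • u''), Lp.coeFn_smul (1 / 2 : ℝ) u'',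
      Lp.coeFn_smul (1 / 2 : ℝ) hm2.toLp, hm2.coeFn_toLp] with t h1 h2 h3 h4 h5 h6
    rw [h1, h2, Pi.add_apply, h3, Pi.neg_apply, h4, h5, Pi.smul_apply, Pi.smul_apply, h6]
    module
  set w := stdOrthonormalBasis ℝ W i.2
  have h3 : ⟪gaussL2 w (hermitePoly i.1), hm2.toLp⟫_ℝ =
      ⟪gaussL2 w (X * (X * hermitePoly i.1)), v⟫_ℝ := by
    rw [inner_gaussL2, inner_gaussL2]
    refine integral_congr_ae ?_
    filter_upwards [hm2.coeFn_toLp] with t ht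
    rw [ht, gaussPoly_X_mul, gaussPoly_X_mul, real_inner_smul_right]
    ring
  -- Both derivatives are moved onto the Hermite function, where the eigenvalue equation applies.
  have h4 := h2.inner_gaussL2 w (hermitePoly i.1)
  have h5 := h1.inner_gaussL2 w (derivative (hermitePoly i.1) - X * hermitePoly i.1)
  rw [second_derivative_hermitePoly, map_sub, inner_sub_left, map_smul, real_inner_smul_left] at h5
  rw [hfe, inner_add_right, inner_neg_right, real_inner_smul_right,
    real_inner_smul_right, h3]
  linear_combination (1 / 2 : ℝ) * h5 - (1 / 2 : ℝ) * h4

section Inverse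

variable {K : L2Line W →L[ℝ] L2Line W}

theorem inner_hermiteBasis_inverse
    (hK : ∀ i, K (hermiteBasis W i) = (i.1 + 1 / 2 : ℝ)⁻¹ • hermiteBasis W i)
    (i : ℕ × Fin (Module.finrank ℝ W)) (f : L2Line W) :
    ⟪hermiteBasis W i, K f⟫_ℝ = (i.1 + 1 / 2 : ℝ)⁻¹ * ⟪hermiteBasis W i, f⟫_ℝ := by
  classical
  have h : innerSL ℝ (hermiteBasis W i) ∘L K =
      (i.1 + 1 / 2 : ℝ)⁻¹ • innerSL ℝ (hermiteBasis W i) := by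
    refine (hermiteBasis W).clm_ext fun j => ?_
    simp only [ContinuousLinearMap.comp_apply, hK, smul_apply, innerSL_apply_apply,
      real_inner_smul_right, smul_eq_mul, orthonormal_iff_ite.1 (hermiteBasis W).orthonormal]
    by_cases hij : i = j <;> simp [hij]
  exact DFunLike.congr_fun h f

theorem harmonicOscillator_inverse_symm
    (hK : ∀ i, K (hermiteBasis W i) = (i.1 + 1 / 2 : ℝ)⁻¹ • hermiteBasis W i)
    (f g : L2Line W) : ⟪K f, g⟫_ℝ = ⟪f, K g⟫_ℝ := by
  rw [← (hermiteBasis W).tsum_inner_mul_inner, ← (hermiteBasis W).tsum_inner_mul_inner]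
  refine tsum_congr fun i => ?_
  rw [real_inner_comm, inner_hermiteBasis_inverse hK, inner_hermiteBasis_inverse hK,
    real_inner_comm f]
  ring

theorem HarmonicOscillatorGraph.eq_inverse [CompleteSpace W]
    (hK : ∀ i, K (hermiteBasis W i) = (i.1 + 1 / 2 : ℝ)⁻¹ • hermiteBasis W i)
    {v f : L2Line W} (h : HarmonicOscillatorGraph v f) :
    v = K f := by
  refine (hermiteBasis W).ext_inner fun i => ?_
  have : (i.1 + 1 / 2 : ℝ) ≠ 0 := by positivity
  rw [inner_hermiteBasis_inverse hK, h.inner_hermiteBasis, inv_mul_cancel_left₀ this]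

theorem harmonicOscillator_inverse_injective
    (hK : ∀ i, K (hermiteBasis W i) = (i.1 + 1 / 2 : ℝ)⁻¹ • hermiteBasis W i) :
    Function.Injective K := by
  refine (injective_iff_map_eq_zero K).2 fun f hf => ?_
  refine (hermiteBasis W).ext_inner fun i => ?_
  have h := inner_hermiteBasis_inverse hK i f
  have : (i.1 + 1 / 2 : ℝ)⁻¹ ≠ 0 := by positivity
  rw [hf, inner_zero_right, zero_eq_mul] at h
  rw [inner_zero_right, h.resolve_left this]

/-- The Hilbert–Schmidt property of `K`: `∑ (n + 1/2)⁻²` converges and each eigenvalue has the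
finite multiplicity `dim W`. -/
theorem summable_norm_sq_harmonicOscillator_inverse
    (hK : ∀ i, K (hermiteBasis W i) = (i.1 + 1 / 2 : ℝ)⁻¹ • hermiteBasis W i) :
    Summable fun i => ‖K (hermiteBasis W i)‖ ^ 2 := by
  have h1 : Summable fun n : ℕ => ((n + 1 / 2 : ℝ)⁻¹) ^ 2 := by
    have := (Real.summable_one_div_nat_add_rpow (1 / 2) 2).2 one_lt_two
    refine this.congr fun n => ?_
    rw [Real.rpow_two, sq_abs, one_div, inv_pow]
  have h2 : Summable fun i : ℕ × Fin (Module.finrank ℝ W) => ((i.1 + 1 / 2 : ℝ)⁻¹) ^ 2 * 1 :=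
    Summable.mul_of_nonneg h1
      (Summable.of_finite (f := fun _ : Fin (Module.finrank ℝ W) => (1 : ℝ)))
      (fun _ => by positivity) fun _ => zero_le_one
  refine h2.congr fun i => ?_
  rw [hK, norm_smul, (hermiteBasis W).orthonormal.1, mul_one, mul_one, Real.norm_eq_abs, sq_abs]

/-- The norm `‖K h‖` is the norm of `h` in the dual of the domain of the harmonic oscillator. -/
theorem isGelfandDualNorm_inverse [CompleteSpace W]
    (hK : ∀ i, K (hermiteBasis W i) = (i.1 + 1 / 2 : ℝ)⁻¹ • hermiteBasis W i)
    (hgraph : ∀ h, HarmonicOscillatorGraph (K h) h) (h : L2Line W) :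
    IsGelfandDualNorm h ‖K h‖ := by
  -- With `v = K f` the functional is `⟪K h, f⟫ - ‖f‖² / 2`, whose maximum is attained at `f = K h`.
  refine ⟨norm_nonneg _, ?_, fun c hc => hc ⟨K (K h), K h, hgraph _, ?_⟩⟩
  · rintro _ ⟨v, f, hvf, rfl⟩
    rw [hvf.eq_inverse hK, ← harmonicOscillator_inverse_symm hK]
    have := norm_sub_sq_real (K h) f
    nlinarith [sq_nonneg ‖K h - f‖]
  · rw [← harmonicOscillator_inverse_symm hK, real_inner_self_eq_norm_sq]
    ring

end Inverse

end HarmonicOscillator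

/-! ### Translations of `L²(ℝ; W)` and their commutation with the oscillator. -/

section Translation

variable {W : Type*} [NormedAddCommGroup W] [InnerProductSpace ℝ W]

variable (W) in
/-- The translation `u ↦ u (· - s)` of `L²(ℝ; W)`. -/
noncomputable def translateL2 (s : ℝ) : L2Line W →ₗᵢ[ℝ] L2Line W :=
  Lp.compMeasurePreservingₗᵢ ℝ (fun y : ℝ => y - s) (measurePreserving_sub_right volume s)

theorem coeFn_translateL2 (s : ℝ) (u : L2Line W) :
    translateL2 W s u =ᵐ[volume] fun y => u (y - s) :=
  Lp.coeFn_compMeasurePreserving u (measurePreserving_sub_right volume s)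

theorem ae_comp_sub {p : ℝ → Prop} (h : ∀ᵐ x : ℝ, p x) (s : ℝ) : ∀ᵐ y : ℝ, p (y - s) :=
  (measurePreserving_sub_right volume s).quasiMeasurePreserving.ae h

theorem translateL2_add (s t : ℝ) (u : L2Line W) :
    translateL2 W (s + t) u = translateL2 W s (translateL2 W t u) := by
  refine Lp.ext ?_
  filter_upwards [coeFn_translateL2 (s + t) u, coeFn_translateL2 s (translateL2 W t u),
    ae_comp_sub (coeFn_translateL2 t u) s] with y h1 h2 h3
  rw [h1, h2, h3, sub_sub]

theorem integral_smul_translateL2 (φ : ℝ → ℝ) (s : ℝ) (u : L2Line W) :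
    ∫ y, φ y • translateL2 W s u y = ∫ x, φ (x + s) • u x := by
  rw [← integral_sub_right_eq_self (fun x => φ (x + s) • u x) s]
  refine integral_congr_ae ?_
  filter_upwards [coeFn_translateL2 s u] with y hy
  rw [hy, sub_add_cancel]

theorem IsWeakDeriv.translateL2 {u v : L2Line W} (h : IsWeakDeriv u v) (s : ℝ) :
    IsWeakDeriv (translateL2 W s u) (translateL2 W s v) := by
  intro φ hφ hc
  rw [integral_smul_translateL2, integral_smul_translateL2]
  have h1 := h (fun x => φ (x + s)) (hφ.comp (contDiff_id.add contDiff_const))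
    (hc.comp_homeomorph (Homeomorph.addRight s))
  simpa only [deriv_comp_add_const] using h1

/-- Weak derivatives commute with translation, and the potential seen from the shifted point is `(x
+ s)² / 2 = x² / 2 + s x + s² / 2`. -/
theorem HarmonicOscillatorGraph.translateL2 {v f g : L2Line W} (h : HarmonicOscillatorGraph v f)
    (hg : ∀ᵐ t : ℝ, g t = t • v t) (s : ℝ) :
    HarmonicOscillatorGraph (translateL2 W s v)
      (translateL2 W s (f + s • g + (s ^ 2 / 2) • v)) := by
  obtain ⟨hm, u', u'', h1, h2, hf⟩ := h
  refine ⟨?_, _, _, h1.translateL2 s, h2.translateL2 s, ?_⟩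
  · have h3 : MemLp (fun x : ℝ => (1 + (x + s) ^ 2) • v x) 2 := by
      refine ((hm.add ((Lp.memLp g).const_smul (2 * s))).add
        ((Lp.memLp v).const_smul (s ^ 2))).ae_eq ?_
      filter_upwards [hg] with t ht
      simp only [Pi.add_apply, Pi.smul_apply, ht]
      module
    refine (h3.comp_measurePreserving (measurePreserving_sub_right volume s)).ae_eq ?_
    filter_upwards [coeFn_translateL2 s v] with y hy
    rw [hy, Function.comp_apply, sub_add_cancel]
  · filter_upwards [coeFn_translateL2 s v, coeFn_translateL2 s u'',
      coeFn_translateL2 s (f + s • g + (s ^ 2 / 2) • v), ae_comp_sub hf s, ae_comp_sub hg s,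
      ae_comp_sub (Lp.coeFn_add (f + s • g) ((s ^ 2 / 2) • v)) s,
      ae_comp_sub (Lp.coeFn_add f (s • g)) s, ae_comp_sub (Lp.coeFn_smul s g) s,
      ae_comp_sub (Lp.coeFn_smul (s ^ 2 / 2) v) s] with y e1 e2 e3 e4 e5 e6 e7 e8 e9
    rw [e1, e2, e3, e6, Pi.add_apply, e7, Pi.add_apply, e8, e9, Pi.smul_apply, Pi.smul_apply, e4,
      e5]
    module

end Translation

/-! ### Square root of `D + D†`. -/

section OperatorSquareRoot

variable {W : Type*} [NormedAddCommGroup W] [InnerProductSpace ℝ W] [CompleteSpace W]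
  [FiniteDimensional ℝ W]

/-- A strictly positive quadratic form `⟪D w, w⟫` gives an invertible `R` with `R† R = D + D†`. -/
theorem exists_injective_inner_eq {D : W →L[ℝ] W} (hD : ∀ w, w ≠ 0 → 0 < ⟪D w, w⟫_ℝ) :
    ∃ R : W →L[ℝ] W, Function.Injective R ∧
      ∀ v w, ⟪R v, R w⟫_ℝ = ⟪D v, w⟫_ℝ + ⟪v, D w⟫_ℝ := by
  set G : W →ₗ[ℝ] W := (D + ContinuousLinearMap.adjoint D).toLinearMap
  have hGi : ∀ v w, ⟪G v, w⟫_ℝ = ⟪D v, w⟫_ℝ + ⟪v, D w⟫_ℝ := fun v w => by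
    simp [G, inner_add_left, ContinuousLinearMap.adjoint_inner_left]
  have hG : G.IsSymmetric := fun v w => by
    rw [hGi, real_inner_comm (G w) v, hGi, real_inner_comm (D v), real_inner_comm v]
    ring
  set e := hG.eigenvectorBasis rfl
  set ev := hG.eigenvalues rfl
  have hev : ∀ i, 0 < ev i := fun i => by
    have h1 : ⟪G (e i), e i⟫_ℝ = ev i := by
      rw [hG.apply_eigenvectorBasis rfl i, real_inner_smul_left, real_inner_self_eq_norm_sq,
        e.orthonormal.1 i]
      simp [ev]
    have h2 := hD (e i) (e.orthonormal.ne_zero i)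
    rw [← h1, hGi, real_inner_comm (D _)]
    linarith
  -- The symmetric square root of `D + D†`, written in an eigenbasis.
  let R : W →ₗ[ℝ] W := ∑ i, √(ev i) • (innerₛₗ ℝ (e i)).smulRight (e i)
  have hR : ∀ v i, ⟪e i, R v⟫_ℝ = √(ev i) * ⟪e i, v⟫_ℝ := fun v i => by
    simp only [R, LinearMap.sum_apply, LinearMap.smul_apply, LinearMap.smulRight_apply,
      innerₛₗ_apply_apply, inner_sum, real_inner_smul_right,
      orthonormal_iff_ite.1 e.orthonormal]
    simp
  refine ⟨LinearMap.toContinuousLinearMap R, ?_, fun v w => ?_⟩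
  · refine (injective_iff_map_eq_zero _).2 fun v hv => ?_
    apply e.repr.injective
    ext i
    have h1 := hR v i
    have h2 : R v = 0 := hv
    rw [h2, inner_zero_right, zero_eq_mul] at h1
    simpa [e.repr_apply_apply] using h1.resolve_left (Real.sqrt_pos.2 (hev i)).ne'
  · rw [← hGi]
    change ⟪R v, R w⟫_ℝ = _
    rw [← e.sum_inner_mul_inner, ← e.sum_inner_mul_inner (G v)]
    refine Finset.sum_congr rfl fun i _ => ?_
    rw [real_inner_comm, hR, hR, hG v (e i), hG.apply_eigenvectorBasis rfl i,
      real_inner_smul_right]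
    have := Real.mul_self_sqrt (hev i).le
    simp only [RCLike.ofReal_real_eq_id, id]
    linear_combination ⟪v, e i⟫_ℝ * ⟪e i, w⟫_ℝ * this +
      √(ev i) ^ 2 * ⟪e i, w⟫_ℝ * real_inner_comm v (e i)

end OperatorSquareRoot

/-! ### The flow `exp (y D)` and positivity of `D`. -/

section ExponentialFlow

variable {W : Type*} [NormedAddCommGroup W] [InnerProductSpace ℝ W]

/-- The operators `exp (y D)`. -/
noncomputable def expFlow (D : W →L[ℝ] W) (y : ℝ) : W →L[ℝ] W := NormedSpace.exp (y • D)

theorem expFlow_zero (D : W →L[ℝ] W) (w : W) : expFlow D 0 w = w := by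
  simp [expFlow]

variable [CompleteSpace W]

theorem expFlow_add (D : W →L[ℝ] W) (x y : ℝ) (w : W) :
    expFlow D (x + y) w = expFlow D x (expFlow D y w) := by
  let _ : NormedAlgebra ℚ (W →L[ℝ] W) := NormedAlgebra.restrictScalars ℚ ℝ (W →L[ℝ] W)
  have h : Commute (x • D) (y • D) := ((Commute.refl D).smul_left x).smul_right y
  rw [expFlow, add_smul, NormedSpace.exp_add_of_commute h]
  rfl

theorem expFlow_neg_apply_expFlow (D : W →L[ℝ] W) (y : ℝ) (w : W) :
    expFlow D y (expFlow D (-y) w) = w := by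
  rw [← expFlow_add, add_neg_cancel, expFlow_zero]

theorem hasDerivAt_expFlow (D : W →L[ℝ] W) (w : W) (y : ℝ) :
    HasDerivAt (fun y => expFlow D y w) (D (expFlow D y w)) y := by
  have h := (hasDerivAt_exp_smul_const' (𝕂 := ℝ) D y).clm_apply (hasDerivAt_const y w)
  simpa [expFlow] using h

theorem continuous_expFlow (D : W →L[ℝ] W) (w : W) : Continuous fun y => expFlow D y w :=
  continuous_iff_continuousAt.2 fun y => (hasDerivAt_expFlow D w y).continuousAt

/-- The bound `⟪exp (-t D) w, w⟫ ≤ exp (-δ t) ‖w‖²` is an equality at `t = 0`; comparing right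
derivatives there gives `⟪D w, w⟫ ≥ δ ‖w‖²`. -/
theorem inner_pos_of_norm_expFlow_le {D : W →L[ℝ] W} {δ : ℝ} (hδ : 0 < δ)
    (hD : ∀ y ≤ 0, ‖expFlow D y‖ ≤ Real.exp (δ * y)) {w : W} (hw : w ≠ 0) : 0 < ⟪D w, w⟫_ℝ := by
  have hle : ∀ t : ℝ, 0 ≤ t → ⟪expFlow D (-t) w, w⟫_ℝ ≤ Real.exp (δ * -t) * ‖w‖ ^ 2 := by
    intro t ht
    calc ⟪expFlow D (-t) w, w⟫_ℝ ≤ ‖expFlow D (-t) w‖ * ‖w‖ := real_inner_le_norm _ _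
      _ ≤ (Real.exp (δ * -t) * ‖w‖) * ‖w‖ := by
        gcongr
        exact (expFlow D (-t)).le_of_opNorm_le (hD _ (by linarith)) w
      _ = _ := by ring
  have h1 : HasDerivAt (fun t : ℝ => Real.exp (δ * -t) * ‖w‖ ^ 2 - ⟪expFlow D (-t) w, w⟫_ℝ)
      (-δ * ‖w‖ ^ 2 + ⟪D w, w⟫_ℝ) 0 := by
    have hn : HasDerivAt (fun t : ℝ => -t) (-1) 0 := hasDerivAt_neg 0
    have e1 := ((hn.const_mul δ).exp).mul_const (‖w‖ ^ 2)
    have h0 : HasDerivAt (fun y => expFlow D y w) (D (expFlow D (-0) w)) (-0) :=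
      hasDerivAt_expFlow D w (-0)
    have e2 := (h0.scomp (0 : ℝ) hn).inner ℝ (hasDerivAt_const (0 : ℝ) w)
    refine (e1.sub e2).congr_deriv ?_
    simp [expFlow_zero]
  have h2 := h1.tendsto_slope_zero_right
  have h3 : 0 ≤ -δ * ‖w‖ ^ 2 + ⟪D w, w⟫_ℝ := by
    refine ge_of_tendsto h2 ?_
    filter_upwards [self_mem_nhdsWithin] with t ht
    have ht' : 0 < t := ht
    have := hle t ht'.le
    simp only [zero_add, neg_zero, mul_zero, Real.exp_zero, one_mul, expFlow_zero,
      real_inner_self_eq_norm_sq, sub_self, sub_zero, smul_eq_mul]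
    exact mul_nonneg (by positivity) (by linarith)
  have : 0 < δ * ‖w‖ ^ 2 := by positivity
  linarith

end ExponentialFlow

/-! ### The model vectors in `L²(ℝ; W)`: Gram matrix and totality. -/

section TranslationModel

variable {W : Type*} [NormedAddCommGroup W] [InnerProductSpace ℝ W]

theorem integrableOn_Iic_mul_of_le_exp {f g : ℝ → W} (hf : Continuous f) (hg : Continuous g)
    {δ A B : ℝ} (hδ : 0 < δ) (hfA : ∀ y ≤ 0, ‖f y‖ ≤ A * Real.exp (δ * y))
    (hgB : ∀ y ≤ 0, ‖g y‖ ≤ B * Real.exp (δ * y)) :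
    IntegrableOn (fun y => ⟪f y, g y⟫_ℝ) (Set.Iic 0) := by
  have h := (integrableOn_exp_mul_Iic (a := 2 * δ) (by positivity) 0).const_mul (A * B)
  refine h.mono' (hf.inner hg).aestronglyMeasurable ?_
  filter_upwards [ae_restrict_mem measurableSet_Iic] with y hy
  have h1 := hfA y hy
  have h2 := hgB y hy
  have e : Real.exp (2 * δ * y) = Real.exp (δ * y) * Real.exp (δ * y) := by
    rw [← Real.exp_add]; ring_nf
  calc ‖⟪f y, g y⟫_ℝ‖ ≤ ‖f y‖ * ‖g y‖ := norm_inner_le_norm _ _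
    _ ≤ (A * Real.exp (δ * y)) * (B * Real.exp (δ * y)) :=
      mul_le_mul h1 h2 (norm_nonneg _) ((norm_nonneg _).trans h1)
    _ = _ := by rw [e]; ring

theorem norm_comp_expFlow_le {D : W →L[ℝ] W} {δ : ℝ}
    (hD : ∀ y ≤ 0, ‖expFlow D y‖ ≤ Real.exp (δ * y)) (R : W →L[ℝ] W)
    (w : W) {y : ℝ} (hy : y ≤ 0) : ‖R (expFlow D y w)‖ ≤ (‖R‖ * ‖w‖) * Real.exp (δ * y) := by
  calc ‖R (expFlow D y w)‖ ≤ ‖R‖ * ‖expFlow D y w‖ := R.le_opNorm _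
    _ ≤ ‖R‖ * (Real.exp (δ * y) * ‖w‖) := by
      gcongr
      exact (expFlow D y).le_of_opNorm_le (hD y hy) w
    _ = _ := by ring

variable [CompleteSpace W] {D R : W →L[ℝ] W} {δ : ℝ}

theorem memLp_indicator_expFlow (hδ : 0 < δ) (hD : ∀ y ≤ 0, ‖expFlow D y‖ ≤ Real.exp (δ * y))
    (R : W →L[ℝ] W) (w : W) :
    MemLp ((Set.Iic (0 : ℝ)).indicator fun y => R (expFlow D y w)) 2 := by
  have hc : Continuous fun y => R (expFlow D y w) := R.continuous.comp (continuous_expFlow D w)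
  rw [memLp_indicator_iff_restrict measurableSet_Iic,
    memLp_two_iff_integrable_sq_norm hc.aestronglyMeasurable]
  simp only [← real_inner_self_eq_norm_sq]
  exact integrableOn_Iic_mul_of_le_exp hc hc hδ (fun y hy => norm_comp_expFlow_le hD R w hy)
    fun y hy => norm_comp_expFlow_le hD R w hy

/-- The function `1_{y ≤ 0} R exp (y D) w` in `L²(ℝ; W)`. -/
noncomputable def modelVector (hδ : 0 < δ) (hD : ∀ y ≤ 0, ‖expFlow D y‖ ≤ Real.exp (δ * y))
    (R : W →L[ℝ] W) (w : W) : L2Line W :=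
  (memLp_indicator_expFlow hδ hD R w).toLp

theorem coeFn_translateL2_modelVector (hδ : 0 < δ)
    (hD : ∀ y ≤ 0, ‖expFlow D y‖ ≤ Real.exp (δ * y)) (R : W →L[ℝ] W) (t : ℝ) (w : W) :
    translateL2 W t (modelVector hδ hD R w) =ᵐ[volume]
      (Set.Iic t).indicator fun y => R (expFlow D (y - t) w) := by
  filter_upwards [coeFn_translateL2 t (modelVector hδ hD R w),
    ae_comp_sub (memLp_indicator_expFlow hδ hD R w).coeFn_toLp t] with y h1 h2
  rw [h1, modelVector, h2]
  simp only [Set.indicator_apply, Set.mem_Iic, sub_nonpos]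

/-- For `t ≥ 0` only `y ≤ 0` contributes. By the choice of `R` the integrand there is the derivative
of `⟪exp (y D) v', exp (y D) w⟫` with `v' = exp (-t D) v`, which tends to zero at `-∞`. -/
theorem inner_translateL2_modelVector (hδ : 0 < δ)
    (hD : ∀ y ≤ 0, ‖expFlow D y‖ ≤ Real.exp (δ * y))
    (hR : ∀ v w, ⟪R v, R w⟫_ℝ = ⟪D v, w⟫_ℝ + ⟪v, D w⟫_ℝ) {t : ℝ} (ht : 0 ≤ t) (v w : W) :
    ⟪translateL2 W t (modelVector hδ hD R v), modelVector hδ hD R w⟫_ℝ =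
      ⟪expFlow D (-t) v, w⟫_ℝ := by
  set v' := expFlow D (-t) v
  have h1 : ⟪translateL2 W t (modelVector hδ hD R v), modelVector hδ hD R w⟫_ℝ =
      ∫ y in Set.Iic 0, ⟪R (expFlow D y v'), R (expFlow D y w)⟫_ℝ := by
    rw [L2.inner_def, ← integral_indicator measurableSet_Iic]
    refine integral_congr_ae ?_
    filter_upwards [coeFn_translateL2_modelVector hδ hD R t v,
      (memLp_indicator_expFlow hδ hD R w).coeFn_toLp] with y h1 h2
    rw [h1, modelVector, h2]
    by_cases hy : y ≤ 0
    · have hyt : y ≤ t := hy.trans ht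
      simp [hy, hyt, sub_eq_add_neg, expFlow_add, v']
    · simp [hy]
  have hder : ∀ y : ℝ, HasDerivAt (fun y => ⟪expFlow D y v', expFlow D y w⟫_ℝ)
      ⟪R (expFlow D y v'), R (expFlow D y w)⟫_ℝ y := fun y => by
    refine ((hasDerivAt_expFlow D v' y).inner ℝ (hasDerivAt_expFlow D w y)).congr_deriv ?_
    rw [hR, add_comm]
  have hlim : Filter.Tendsto (fun y => ⟪expFlow D y v', expFlow D y w⟫_ℝ) Filter.atBot
      (nhds 0) := by
    have hb : Filter.Tendsto (fun y => (‖v'‖ * ‖w‖) * Real.exp (2 * δ * y)) Filter.atBot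
        (nhds 0) := by
      have := (Real.tendsto_exp_atBot.comp
        (Filter.tendsto_id.const_mul_atBot (show 0 < 2 * δ by positivity))).const_mul (‖v'‖ * ‖w‖)
      simpa using this
    refine squeeze_zero_norm' ?_ hb
    filter_upwards [Filter.eventually_le_atBot 0] with y hy
    have e : Real.exp (2 * δ * y) = Real.exp (δ * y) * Real.exp (δ * y) := by
      rw [← Real.exp_add]; ring_nf
    calc ‖⟪expFlow D y v', expFlow D y w⟫_ℝ‖ ≤ ‖expFlow D y v'‖ * ‖expFlow D y w‖ :=
          norm_inner_le_norm _ _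
      _ ≤ (Real.exp (δ * y) * ‖v'‖) * (Real.exp (δ * y) * ‖w‖) := by
        gcongr
        · exact (expFlow D y).le_of_opNorm_le (hD y hy) _
        · exact (expFlow D y).le_of_opNorm_le (hD y hy) _
      _ = _ := by rw [e]; ring
  have hcont : ∀ x, Continuous fun y => R (expFlow D y x) := fun x =>
    R.continuous.comp (continuous_expFlow D x)
  rw [h1, integral_Iic_of_hasDerivAt_of_tendsto (hder 0).continuousAt.continuousWithinAt
    (fun y _ => hder y)
    (integrableOn_Iic_mul_of_le_exp (hcont v') (hcont w) hδ
      (fun y hy => norm_comp_expFlow_le hD R v' hy) fun y hy => norm_comp_expFlow_le hD R w hy)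
    hlim, sub_zero, expFlow_zero, expFlow_zero]

/-- A locally integrable function with vanishing integrals over all half-lines vanishes. -/
theorem ae_eq_zero_of_setIntegral_Iic_eq_zero {k : ℝ → ℝ}
    (hk : ∀ t, IntegrableOn k (Set.Iic t)) (h0 : ∀ t, ∫ y in Set.Iic t, k y = 0) :
    k =ᵐ[volume] 0 := by
  have hloc : LocallyIntegrable k := fun x => ⟨Set.Iic (x + 1), Iic_mem_nhds (by linarith), hk _⟩
  filter_upwards [_root_.LocallyIntegrable.ae_hasDerivAt_integral hloc] with x hx
  have h := hx 0
  have hz : (fun x => ∫ t in (0 : ℝ)..x, k t) = fun _ => 0 := by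
    ext x
    rw [← intervalIntegral.integral_Iic_sub_Iic (hk 0) (hk x), h0, h0, sub_zero]
  rw [hz] at h
  exact h.unique (hasDerivAt_const x 0)

/-- Testing with `exp (t D) w` in place of `w` makes the integrand independent of `t`, so its
integrals over all half-lines vanish and it is zero almost everywhere. A basis of `W` gives a common
null set, and surjectivity of `R exp (y D)` concludes. -/
theorem eq_zero_of_inner_translateL2_modelVector_eq_zero [FiniteDimensional ℝ W] (hδ : 0 < δ)
    (hD : ∀ y ≤ 0, ‖expFlow D y‖ ≤ Real.exp (δ * y)) (hR : Function.Injective R) {g : L2Line W}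
    (hg : ∀ t w, ⟪translateL2 W t (modelVector hδ hD R w), g⟫_ℝ = 0) : g = 0 := by
  have hRs : Function.Surjective R :=
    LinearMap.injective_iff_surjective (f := R.toLinearMap).1 hR
  have h1 : ∀ w, (fun y => ⟪R (expFlow D y w), g y⟫_ℝ) =ᵐ[volume] 0 := by
    intro w
    have e : ∀ t, (fun y => ⟪translateL2 W t (modelVector hδ hD R (expFlow D t w)) y, g y⟫_ℝ)
        =ᵐ[volume] (Set.Iic t).indicator fun y => ⟪R (expFlow D y w), g y⟫_ℝ := fun t => by
      filter_upwards [coeFn_translateL2_modelVector hδ hD R t (expFlow D t w)] with y hy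
      rw [hy]
      by_cases hyt : y ≤ t
      · simp [hyt, ← expFlow_add]
      · simp [hyt]
    refine ae_eq_zero_of_setIntegral_Iic_eq_zero (fun t => ?_) fun t => ?_
    · rw [← integrable_indicator_iff measurableSet_Iic]
      exact (L2.integrable_inner (𝕜 := ℝ) _ _).congr (e t)
    · rw [← integral_indicator measurableSet_Iic, ← integral_congr_ae (e t), ← L2.inner_def, hg]
  have h2 : ∀ᵐ y : ℝ, ∀ j, ⟪R (expFlow D y (stdOrthonormalBasis ℝ W j)), g y⟫_ℝ = 0 :=
    ae_all_iff.2 fun j => h1 _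
  rw [Lp.eq_zero_iff_ae_eq_zero]
  filter_upwards [h2] with y hy
  have h3 : ∀ w, ⟪R (expFlow D y w), g y⟫_ℝ = 0 := fun w => by
    rw [← (stdOrthonormalBasis ℝ W).sum_repr w]
    simp [sum_inner, real_inner_smul_left, hy]
  obtain ⟨x, hx⟩ := hRs (g y)
  have h4 := h3 (expFlow D (-y) x)
  rw [expFlow_neg_apply_expFlow, hx] at h4
  exact inner_self_eq_zero.1 h4

theorem dense_span_translateL2_modelVector [FiniteDimensional ℝ W] (hδ : 0 < δ)
    (hD : ∀ y ≤ 0, ‖expFlow D y‖ ≤ Real.exp (δ * y)) (hR : Function.Injective R) :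
    Dense (Submodule.span ℝ (Set.range fun i : ℝ × W =>
      translateL2 W i.1 (modelVector hδ hD R i.2)) : Set (L2Line W)) := by
  rw [Submodule.dense_iff_topologicalClosure_eq_top,
    Submodule.topologicalClosure_eq_top_iff, Submodule.eq_bot_iff]
  intro g hg
  refine eq_zero_of_inner_translateL2_modelVector_eq_zero hδ hD hR fun t w => ?_
  exact (Submodule.mem_orthogonal _ _).1 hg _ (Submodule.subset_span ⟨(t, w), rfl⟩)

end TranslationModel

/-! ### Unitary groups. -/

section UnitaryGroup

variable {H : Type*} [NormedAddCommGroup H] [InnerProductSpace ℝ H] [CompleteSpace H]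
  {S : ℝ → H →L[ℝ] H}

theorem IsStronglyContinuousUnitaryGroup.inner_map_map (hS : IsStronglyContinuousUnitaryGroup S)
    (t : ℝ) (x y : H) : ⟪S t x, S t y⟫_ℝ = ⟪x, y⟫_ℝ := by
  have h : ContinuousLinearMap.adjoint (S t) ∘L S t = 1 := (hS.mem_unitary t).1
  rw [← ContinuousLinearMap.adjoint_inner_right, ← ContinuousLinearMap.comp_apply, h]
  rfl

theorem IsStronglyContinuousUnitaryGroup.inner_map_left (hS : IsStronglyContinuousUnitaryGroup S)
    (t : ℝ) (x y : H) : ⟪S t x, y⟫_ℝ = ⟪x, S (-t) y⟫_ℝ := by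
  rw [← hS.inner_map_map t x (S (-t) y), ← ContinuousLinearMap.comp_apply, ← hS.map_add,
    add_neg_cancel, hS.map_zero, ContinuousLinearMap.id_apply]

end UnitaryGroup

/-! ### The translation representation of a minimal dilation. -/

section TranslationRepresentation

variable {W : Type*} [NormedAddCommGroup W] [InnerProductSpace ℝ W] [CompleteSpace W]
  [FiniteDimensional ℝ W] {H : Type*} [NormedAddCommGroup H] [InnerProductSpace ℝ H]
  [CompleteSpace H]

/-- A minimal dilation of an exponentially stable semigroup is unitarily equivalent to the
translation group of `L²(ℝ; W)`. -/
theorem IsMinimalDilation.exists_translation_representation {D : W →L[ℝ] W}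
    (hD : ∃ δ : ℝ, 0 < δ ∧ ∀ t : ℝ, 0 ≤ t →
      ‖NormedSpace.exp (-(t • D))‖ ≤ Real.exp (-(δ * t)))
    {Φ : W →ₗᵢ[ℝ] H} {S : ℝ → H →L[ℝ] H}
    (hS : IsMinimalDilation (fun t : ℝ => NormedSpace.exp (-(t • D))) Φ S) :
    ∃ U : H ≃ₗᵢ[ℝ] L2Line W, ∀ t h, U (S t h) = translateL2 W t (U h) := by
  obtain ⟨δ, hδ, hD⟩ := hD
  have hD' : ∀ y ≤ 0, ‖expFlow D y‖ ≤ Real.exp (δ * y) := fun y hy => by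
    have := hD (-y) (by linarith)
    simpa [expFlow] using this
  obtain ⟨R, hRinj, hR⟩ := exists_injective_inner_eq fun w hw =>
    inner_pos_of_norm_expFlow_le hδ hD' hw
  let x : ℝ × W → H := fun i => S i.1 (Φ i.2)
  let y : ℝ × W → L2Line W := fun i => translateL2 W i.1 (modelVector hδ hD' R i.2)
  have hG := hS.unitaryGroup
  -- Applying the inverse of time `s` on both sides leaves `⟪exp (-(t - s) D) v, w⟫`; symmetry
  -- handles the other order of times.
  have hle : ∀ s t v w, s ≤ t → ⟪x (t, v), x (s, w)⟫_ℝ = ⟪y (t, v), y (s, w)⟫_ℝ := by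
    intro s t v w hst
    have h1 : t = s + (t - s) := by ring
    have h2 : x (t, v) = S s (S (t - s) (Φ v)) := by
      rw [← ContinuousLinearMap.comp_apply, ← hG.map_add, ← h1]
    have h3 : y (t, v) = translateL2 W s (translateL2 W (t - s) (modelVector hδ hD' R v)) := by
      rw [← translateL2_add, ← h1]
    have h4 := hS.compression (t - s) (by linarith) v
    rw [h2, h3, hG.inner_map_map, LinearIsometry.inner_map_map,
      inner_translateL2_modelVector hδ hD' hR (by linarith), expFlow, neg_smul, ← h4,
      ContinuousLinearMap.adjoint_inner_left]
    rfl
  have hgram : ∀ i j, ⟪x i, x j⟫_ℝ = ⟪y i, y j⟫_ℝ := by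
    rintro ⟨t, v⟩ ⟨s, w⟩
    rcases le_total s t with h | h
    · exact hle s t v w h
    · rw [real_inner_comm, hle t s w v h, real_inner_comm]
  have hx : Dense (Submodule.span ℝ (Set.range x) : Set H) := by
    convert hS.minimal using 3
    ext z
    simp only [x, Set.mem_range, Prod.exists, Set.mem_iUnion, Set.mem_image, exists_exists_eq_and]
  obtain ⟨U, hU⟩ := exists_linearIsometryEquiv_of_gram hgram hx
    (dense_span_translateL2_modelVector hδ hD' hRinj)
  refine ⟨U, fun t h => ?_⟩
  have hext : U.toContinuousLinearEquiv.toContinuousLinearMap ∘L S t =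
      (translateL2 W t).toContinuousLinearMap ∘L
        U.toContinuousLinearEquiv.toContinuousLinearMap := by
    refine ContinuousLinearMap.ext_on hx ?_
    rintro _ ⟨⟨s, w⟩, rfl⟩
    have h1 : S t (x (s, w)) = x (t + s, w) := by
      simp only [x]
      rw [hG.map_add, ContinuousLinearMap.comp_apply]
    change U (S t (x (s, w))) = translateL2 W t (U (x (s, w)))
    rw [h1, hU, hU]
    exact translateL2_add t s _
  exact DFunLike.congr_fun hext h

end TranslationRepresentation

/-! ### Trace class and the extended group. -/

section ExtendedGroup

variable {H : Type u} [NormedAddCommGroup H] [InnerProductSpace ℝ H] [CompleteSpace H]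

theorem denseRange_of_symm_of_injective {N : H →L[ℝ] H} (hN : ∀ x y, ⟪N x, y⟫_ℝ = ⟪x, N y⟫_ℝ)
    (hinj : Function.Injective N) : DenseRange N := by
  have h : (N.toLinearMap.range).topologicalClosure = ⊤ := by
    rw [Submodule.topologicalClosure_eq_top_iff, Submodule.eq_bot_iff]
    intro x hx
    refine (injective_iff_map_eq_zero N).1 hinj x (ext_inner_left ℝ fun y => ?_)
    rw [← hN, inner_zero_right]
    exact (Submodule.mem_orthogonal _ _).1 hx _ ⟨y, rfl⟩
  exact Submodule.dense_iff_topologicalClosure_eq_top.2 h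

/-- The positive operator `N N†` is its own absolute value, and its trace is the squared
Hilbert–Schmidt norm of `N†`. -/
theorem isTraceClass_comp_adjoint {N : H →L[ℝ] H}
    (hN : ∀ (ι : Type u) (e : HilbertBasis ι ℝ H),
      Summable fun i => ‖ContinuousLinearMap.adjoint N (e i)‖ ^ 2) :
    IsTraceClass (N ∘L ContinuousLinearMap.adjoint N) := by
  refine ⟨N ∘L ContinuousLinearMap.adjoint N, N.isPositive_self_comp_adjoint, ?_, fun ι e => ?_⟩
  · rw [ContinuousLinearMap.adjoint_comp, ContinuousLinearMap.adjoint_adjoint]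
  · refine (hN ι e).congr fun i => ?_
    rw [ContinuousLinearMap.comp_apply, ← ContinuousLinearMap.adjoint_inner_right,
      real_inner_self_eq_norm_sq]

/-- A unitary group for which `N S_s (1 + s Q + s² / 2 N) = S_s N` induces a strongly continuous
group on the completion of `H` for the norm `‖N ·‖`. -/
theorem exists_group_of_commutation {S : ℝ → H →L[ℝ] H} (hS : IsStronglyContinuousUnitaryGroup S)
    {N Q : H →L[ℝ] H} (hN : ∀ x y, ⟪N x, y⟫_ℝ = ⟪x, N y⟫_ℝ) (hd : DenseRange N)
    (hc : ∀ (s : ℝ) (h : H), N (S s (h + s • Q h + (s ^ 2 / 2) • N h)) = S s (N h)) :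
    ∃ Shat : ℝ → H →L[ℝ] H, IsStronglyContinuousGroup Shat ∧
      ∀ (t : ℝ) (h : H), Shat t (N h) = N (S t h) := by
  -- The adjoint of `S (-t) (1 - t Q + t² / 2 N)`, obtained by taking adjoints in the commutation
  -- hypothesis at `s = -t`. Boundedness and strong continuity are visible from the formula; the
  -- group law is checked on the dense range of `N`.
  let Shat : ℝ → H →L[ℝ] H := fun t =>
    S t + (-t) • (ContinuousLinearMap.adjoint Q ∘L S t) + (t ^ 2 / 2) • (N ∘L S t)
  have key : ∀ (t : ℝ) (h : H), Shat t (N h) = N (S t h) := fun t h => by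
    refine ext_inner_right ℝ fun x => ?_
    have h1 := hc (-t) x
    have h2 : ⟪Shat t (N h), x⟫_ℝ =
        ⟪S t (N h), x + (-t) • Q x + ((-t) ^ 2 / 2) • N x⟫_ℝ := by
      simp only [Shat, add_apply, smul_apply, ContinuousLinearMap.comp_apply, inner_add_left,
        inner_add_right, real_inner_smul_left, real_inner_smul_right,
        ContinuousLinearMap.adjoint_inner_left, hN, neg_sq]
    rw [h2, hS.inner_map_left, hN, h1, ← hS.inner_map_left, hN]
  refine ⟨Shat, ⟨?_, fun s t => ?_, fun x => ?_⟩, key⟩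
  · ext x
    simp [Shat, hS.map_zero]
  · refine DFunLike.coe_injective (hd.equalizer (Shat (s + t)).continuous
      (Shat s ∘L Shat t).continuous (funext fun h => ?_))
    simp only [Function.comp_apply, ContinuousLinearMap.comp_apply, key, hS.map_add]
  · have h1 := hS.continuous_apply x
    have h2 : Continuous fun t => ContinuousLinearMap.adjoint Q (S t x) :=
      (ContinuousLinearMap.adjoint Q).continuous.comp h1
    have h3 : Continuous fun t => N (S t x) := N.continuous.comp h1
    change Continuous fun t : ℝ => S t x + (-t) • ContinuousLinearMap.adjoint Q (S t x) +
      (t ^ 2 / 2) • N (S t x)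
    fun_prop

end ExtendedGroup

/-! ### Separability and the main theorem. -/

theorem HilbertBasis.separableSpace {ι E : Type*} [Countable ι] [NormedAddCommGroup E]
    [InnerProductSpace ℝ E] (b : HilbertBasis ι ℝ E) : TopologicalSpace.SeparableSpace E := by
  rw [← TopologicalSpace.isSeparable_univ_iff, ← b.dense_span_range.closure_eq]
  exact ((Set.countable_range b).isSeparable.span (R := ℝ)).closure

theorem mainTheorem8
    {W : Type*} [NormedAddCommGroup W] [InnerProductSpace ℝ W] [CompleteSpace W]
    [FiniteDimensional ℝ W]
    {H : Type u} [NormedAddCommGroup H] [InnerProductSpace ℝ H] [CompleteSpace H]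
    (D : W →L[ℝ] W)
    (hD : ∃ δ : ℝ, 0 < δ ∧ ∀ t : ℝ, 0 ≤ t →
      ‖NormedSpace.exp (-(t • D))‖ ≤ Real.exp (-(δ * t)))
    (Φ : W →ₗᵢ[ℝ] H) (S : ℝ → H →L[ℝ] H)
    (hS : IsMinimalDilation (fun t : ℝ => NormedSpace.exp (-(t • D))) Φ S) :
    ∃ (X : Type u) (_ : NormedAddCommGroup X) (_ : InnerProductSpace ℝ X) (_ : CompleteSpace X)
      (N : H →L[ℝ] X) (Shat : ℝ → X →L[ℝ] X),
      TopologicalSpace.SeparableSpace X ∧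
      Function.Injective N ∧
      DenseRange N ∧
      IsTraceClass (N ∘L ContinuousLinearMap.adjoint N) ∧
      IsStronglyContinuousGroup Shat ∧
      (∀ (t : ℝ) (h : H), Shat t (N h) = N (S t h)) ∧
      ∃ U : H ≃ₗᵢ[ℝ] L2Line W,
        (∀ (t : ℝ) (h : H), ∀ᵐ y : ℝ, U (S t h) y = U h (y - t)) ∧
        ∀ h : H, IsGelfandDualNorm (U h) ‖N h‖ := by
  obtain ⟨U, hU⟩ := hS.exists_translation_representation hD
  obtain ⟨K, Q, hK, hQ, hgraph⟩ := exists_harmonicOscillator_inverse (W := W)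
  let V : H →L[ℝ] L2Line W := U.toContinuousLinearEquiv.toContinuousLinearMap
  let V' : L2Line W →L[ℝ] H := U.symm.toContinuousLinearEquiv.toContinuousLinearMap
  let N : H →L[ℝ] H := V' ∘L K ∘L V
  let Q' : H →L[ℝ] H := V' ∘L Q ∘L V
  have hUN : ∀ h, U (N h) = K (U h) := fun h => U.apply_symm_apply _
  have hUQ : ∀ h, U (Q' h) = Q (U h) := fun h => U.apply_symm_apply _
  have hsymm : ∀ x y, ⟪N x, y⟫_ℝ = ⟪x, N y⟫_ℝ := fun x y => by
    rw [← U.inner_map_map, hUN, harmonicOscillator_inverse_symm hK, ← hUN, U.inner_map_map]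
  have hinj : Function.Injective N := fun x y hxy =>
    U.injective (harmonicOscillator_inverse_injective hK (by rw [← hUN, ← hUN, hxy]))
  have hdense := denseRange_of_symm_of_injective hsymm hinj
  have hc : ∀ (s : ℝ) (h : H), N (S s (h + s • Q' h + (s ^ 2 / 2) • N h)) = S s (N h) := by
    intro s h
    apply U.injective
    have h1 : U (h + s • Q' h + (s ^ 2 / 2) • N h) =
        U h + s • Q (U h) + (s ^ 2 / 2) • K (U h) := by
      rw [U.map_add, U.map_add, U.map_smul, U.map_smul, hUQ, hUN]
    rw [hUN, hU, hU, h1, hUN]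
    exact (((hgraph (U h)).translateL2 (hQ (U h)) s).eq_inverse hK).symm
  obtain ⟨Shat, hShat, hShatN⟩ :=
    exists_group_of_commutation hS.unitaryGroup hsymm hdense hc
  have hnorm : ∀ h, ‖N h‖ = ‖K (U h)‖ := fun h => by rw [← hUN, U.norm_map]
  have hsep : TopologicalSpace.SeparableSpace H := by
    have := (hermiteBasis W).separableSpace
    exact U.symm.surjective.denseRange.separableSpace U.symm.continuous
  refine ⟨H, inferInstance, inferInstance, inferInstance, N, Shat, hsep, hinj, hdense, ?_, hShat,
    hShatN, U, fun t h => ?_, fun h => ?_⟩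
  · refine isTraceClass_comp_adjoint fun ι e => ?_
    -- Summability is known on the Hermite basis; passing to the adjoint transfers it to an
    -- arbitrary basis `e` of `H`.
    have h1 := (hermiteBasis W).summable_norm_sq_adjoint e (V' ∘L K) (by
      refine (summable_norm_sq_harmonicOscillator_inverse hK).congr fun i => ?_
      rw [ContinuousLinearMap.comp_apply]
      exact congrArg (· ^ 2) (U.symm.norm_map _).symm)
    refine h1.congr fun i => ?_
    have h2 : ContinuousLinearMap.adjoint N (e i) = N (e i) :=
      ext_inner_right ℝ fun x => by rw [ContinuousLinearMap.adjoint_inner_left, hsymm]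
    have h3 : ContinuousLinearMap.adjoint (V' ∘L K) (e i) = K (U (e i)) :=
      ext_inner_right ℝ fun x => by
        rw [ContinuousLinearMap.adjoint_inner_left, harmonicOscillator_inverse_symm hK]
        exact (U.inner_map_eq_flip (e i) (K x)).symm
    rw [h2, h3, hnorm]
  · rw [hU]
    exact coeFn_translateL2 t (U h)
  · rw [hnorm]
    exact isGelfandDualNorm_inverse hK hgraph (U h)
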